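/- There are triangulated models $M_0, M_1, M_2, \dots$ (finite sets of triangles meeting edge-to-edge), each having the topology of a sphere with a single hole, and a constant $C$ with the following properties. $M_k$ is the recursive triangulation of the regular $(3\cdot 2^k)$-gon: $M_0$ is a single equilateral triangle, and, for $k\ge 1$, $M_k$ consists of $3\cdot 2^{k-1}$ outer triangles, each formed by three consecutive vertices and together cutting off every second vertex of the $(3\cdot 2^k)$-gon, and of a copy of $M_{k-1}$ that triangulates the central regular $(3\cdot 2^{k-1})$-gon on the remaining vertices. $M_k$ has $n_k=3(2^k-1)+1$ triangles (so the family is infinite), and its dual graph (nodes are the triangles; two triangles are adjacent when they share an edge) is a complete tree of height $k$: all nodes have distance at most $k$ from a root, the nodes at distance less than $k$ have degree three, and the nodes at distance $k$ are leaves. For every $k$ and every subdivision of $M_k$ (a finite triangulation of the same polygon, with triangles meeting edge-to-edge, in which every triangle lies in a triangle of $M_k$), every single triangle strip of the subdivision, that is, every ordering of all its triangles without repetition in which consecutive triangles share an edge, has at least $$3n_k-4\log_2 n_k-C$$ triangles. -/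

import Mathlib

namespace TriangleStrips

open Geometry

/-! ### Triangulated models, their dual graphs, subdivisions and single strips -/

section Models

variable {E : Type*} [AddCommGroup E] [Module ℝ E]

/-- The triangles of a simplicial complex, each given by its set of three vertices. -/
def triangles (K : SimplicialComplex ℝ E) : Set (Finset E) :=
  {t | t ∈ K.faces ∧ t.card = 3}

/-- The number of triangles of a simplicial complex (used for finite complexes only). -/
noncomputable def numTriangles (K : SimplicialComplex ℝ E) : ℕ :=
  (triangles K).ncard

/-- A triangulated model: finitely many triangles meeting edge-to-edge, together with their edges
and vertices, i.e. a finite simplicial complex all of whose faces are faces of triangles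
of the complex. -/
def IsTriangulatedModel (K : SimplicialComplex ℝ E) : Prop :=
  K.faces.Finite ∧ K.faces.Nonempty ∧ ∀ s ∈ K.faces, ∃ t ∈ triangles K, s ⊆ t

/-- The dual graph: its nodes are the triangles, and two different triangles are adjacent when
they have an edge in common. -/
def dualGraph (K : SimplicialComplex ℝ E) : SimpleGraph (triangles K) where
  Adj s t := s ≠ t ∧ ∃ e ∈ K.faces, e.card = 2 ∧ e ⊆ s.1 ∧ e ⊆ t.1
  symm := ⟨fun _ _ h => ⟨h.1.symm, h.2.imp fun _ he => ⟨he.1, he.2.1, he.2.2.2, he.2.2.1⟩⟩⟩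
  loopless := ⟨fun _ h => h.1 rfl⟩

/-- `L` is a (finite) subdivision of `K`: both complexes have the same underlying space, and
each simplex of `L` lies in a simplex of `K`. -/
def IsSubdivision (L K : SimplicialComplex ℝ E) : Prop :=
  L.faces.Finite ∧ L.space = K.space ∧
    ∀ s ∈ L.faces, ∃ t ∈ K.faces, convexHull ℝ (s : Set E) ⊆ convexHull ℝ (t : Set E)

open Classical in
/-- A single triangle strip of `K`: a sequence of triangles of `K`, each one sharing an edge with
the next one, that contains every triangle of `K` exactly once. -/
def IsSingleStrip (K : SimplicialComplex ℝ E) {s t : triangles K}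
    (p : (dualGraph K).Walk s t) : Prop :=
  p.IsHamiltonian

end Models

/-! ### Topology and shape of the dual tree -/

/-- The sphere with a single hole: the unit sphere of three-dimensional space from which an open
hemisphere has been removed. -/
def sphereWithHole : Set (EuclideanSpace ℝ (Fin 3)) :=
  {x | ‖x‖ = 1 ∧ x 2 ≤ 0}

/-- `G` is the complete tree of height `k` in which each node that is not a leaf has degree three:
for some root, all nodes have distance at most `k` from the root, the nodes at distance less
than `k` have degree three, and those at distance `k` are leaves. -/
def IsCompleteCubicTree {V : Type*} (G : SimpleGraph V) (k : ℕ) : Prop :=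
  G.IsTree ∧ ∃ r : V, ∀ v : V, G.dist r v ≤ k ∧
    (G.dist r v < k → (G.neighborSet v).ncard = 3) ∧
    (G.dist r v = k → (G.neighborSet v).ncard ≤ 1)

/-! ### The recursive triangulations of regular polygons -/

/-- The `i`-th vertex of the regular `N`-gon inscribed in the unit circle, starting from `(1, 0)`
and in counterclockwise order. -/
noncomputable def polygonVertex (N i : ℕ) : EuclideanSpace ℝ (Fin 2) :=
  !₂[Real.cos (2 * Real.pi * i / N), Real.sin (2 * Real.pi * i / N)]

open Classical in
/-- The triangle spanned by the vertices `a`, `b`, `c` of the regular `N`-gon. -/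
noncomputable def polygonTriangle (N a b c : ℕ) : Finset (EuclideanSpace ℝ (Fin 2)) :=
  {polygonVertex N a, polygonVertex N b, polygonVertex N c}

/-- The triangles of the recursive triangulation of the regular `3 * 2 ^ k`-gon. For `k = 0` there
is a single equilateral triangle. The triangulation of the `3 * 2 ^ (k + 1)`-gon has
`3 * 2 ^ k` outer triangles, which cut off every second vertex; they surround the regular
`3 * 2 ^ k`-gon on the remaining vertices, which is triangulated recursively. -/
noncomputable def recursiveTriangles : ℕ → Set (Finset (EuclideanSpace ℝ (Fin 2)))
  | 0 => {polygonTriangle 3 0 1 2}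
  | k + 1 =>
      {t | ∃ i < 3 * 2 ^ k,
        t = polygonTriangle (3 * 2 ^ (k + 1)) (2 * i) (2 * i + 1) (2 * i + 2)} ∪
      recursiveTriangles k

end TriangleStrips

/-!
Fix a linear functional that is injective on the vertices of the subdivision. Every triangle of the
subdivision then has exactly one median vertex, so triangles can be counted by their medians. Inside
a triangle `T` of the model there is one whose median is the median of `T`, and whenever an edge
shared by two triangles of the model contains a further vertex of the subdivision, that vertex is
the median of one more triangle on either side of the edge. A subdivision of a model with `n`
triangles and `r` subdivided inner edges therefore has at least `n + 2 r` triangles.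

When the dual graph is a tree, a single strip must subdivide every inner edge off the tree path
between the models of its two ends: otherwise it would have to cross this bridge forth and back
through one and the same triangle. That path has at most `2 k` of the `n - 1` inner edges, which
gives the bound `n + 2 (n - 1 - 2 k) = 3 n - 4 k - 2`, and `2 ^ k ≤ n`.
-/

namespace TriangleStrips

open Geometry Set Topology

section ConvexHull

variable {E : Type*} [AddCommGroup E] [Module ℝ E]

theorem mem_convexHull_zeros {s : Set E} {g : E →ᵃ[ℝ] ℝ} (hg : ∀ y ∈ s, 0 ≤ g y) {x : E}
    (hx : x ∈ convexHull ℝ s) (hgx : g x = 0) : x ∈ convexHull ℝ {y ∈ s | g y = 0} := by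
  set Z := convexHull ℝ {y ∈ s | g y = 0}
  have hZ : ∀ y ∈ Z, g y = 0 := fun y hy => convexHull_min (t := g ⁻¹' {0}) (fun _ h => h.2)
    ((convex_singleton 0).affine_preimage g) hy
  have hconv : Convex ℝ ({y | 0 < g y} ∪ Z) := by
    refine convex_iff_forall_pos.2 fun y hy z hz a b ha hb hab => ?_
    have hyz := Convex.combo_affine_apply (x := y) (y := z) (f := g) hab
    simp only [smul_eq_mul] at hyz
    rcases hy with hy | hy <;> rcases hz with hz | hz
    · exact Or.inl (by rw [mem_ofPred_eq] at *; rw [hyz]; positivity)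
    · exact Or.inl (by rw [mem_ofPred_eq] at *; rw [hyz, hZ z hz, mul_zero, add_zero]; positivity)
    · exact Or.inl (by rw [mem_ofPred_eq] at *; rw [hyz, hZ y hy, mul_zero, zero_add]; positivity)
    · exact Or.inr (convex_convexHull ℝ _ hy hz ha.le hb.le hab)
  have hs : s ⊆ {y | 0 < g y} ∪ Z := fun y hy =>
    (hg y hy).lt_or_eq.imp id fun h => subset_convexHull ℝ _ ⟨hy, h.symm⟩
  exact (convexHull_min hs hconv hx).resolve_left hgx.not_gt

theorem exists_apply_lt_of_mem_convexHull {s : Set E} {f : E →ₗ[ℝ] ℝ} {v : E}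
    (hv : v ∈ convexHull ℝ s) (hf : ∀ y ∈ s, f y ≠ f v) : ∃ a ∈ s, f a < f v := by
  by_contra! hle
  have hv' := mem_convexHull_zeros (g := f.toAffineMap - AffineMap.const ℝ E (f v))
    (fun y hy => sub_nonneg.2 (hle y hy)) hv (sub_self _)
  obtain ⟨y, hy, hy0⟩ := convexHull_nonempty_iff.1 ⟨v, hv'⟩
  exact hf y hy (sub_eq_zero.1 hy0)

theorem eq_of_mem_convexHull_of_apply_eq {s : Set E} {f : E →ₗ[ℝ] ℝ} (hf : InjOn f s) {v x : E}
    (hv : v ∈ s) (hle : ∀ y ∈ s, f v ≤ f y) (hx : x ∈ convexHull ℝ s) (hfx : f x = f v) :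
    x = v := by
  have hx' := mem_convexHull_zeros (g := f.toAffineMap - AffineMap.const ℝ E (f v))
    (fun y hy => sub_nonneg.2 (hle y hy)) hx (sub_eq_zero.2 hfx)
  have hv' : {y ∈ s | (f.toAffineMap - AffineMap.const ℝ E (f v)) y = 0} ⊆ {v} :=
    fun y hy => hf hy.1 hv (sub_eq_zero.1 hy.2)
  simpa using convexHull_mono hv' hx'

theorem exists_linearMap_injOn {s : Set E} (hs : s.Finite) : ∃ f : E →ₗ[ℝ] ℝ, InjOn f s := by
  have := hs.to_subtype
  obtain ⟨f, hf⟩ := Module.exists_dual_forall_apply_ne_zero (K := ℝ)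
    (fun p : {p : s × s // p.1 ≠ p.2} => (p.1.1 - p.1.2 : E))
    fun p => sub_ne_zero.2 (Subtype.coe_injective.ne p.2)
  refine ⟨f, fun x hx y hy hxy => by_contra fun hne => ?_⟩
  exact hf ⟨(⟨x, hx⟩, ⟨y, hy⟩), fun h => hne (congrArg Subtype.val h)⟩ (by simp [hxy])

theorem mem_of_mem_convexHull_of_card_le_one {s : Finset E} (hs : s.card ≤ 1) {x : E}
    (hx : x ∈ convexHull ℝ (s : Set E)) : x ∈ s := by
  rcases Finset.card_le_one_iff_subset_singleton.1 hs with ⟨y, hy⟩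
  rcases Finset.subset_singleton_iff.1 hy with rfl | rfl <;> simp_all

theorem coe_subset_vertices {K : SimplicialComplex ℝ E} {s : Finset E} (hs : s ∈ K.faces) :
    (s : Set E) ⊆ K.vertices := by
  rw [K.vertices_eq]
  exact subset_biUnion_of_mem (u := fun s : Finset E => (s : Set E)) hs

end ConvexHull

section Interior

variable {E : Type*} [NormedAddCommGroup E] [NormedSpace ℝ E]

theorem subset_closure_interior {s : Set E} (hs : Convex ℝ s) (hint : (interior s).Nonempty) :
    s ⊆ closure (interior s) :=
  (hs.closure_interior_eq_closure_of_nonempty_interior hint).symm ▸ subset_closure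

theorem exists_mem_interior_apply_eq {s : Set E} (hs : Convex ℝ s) (hint : (interior s).Nonempty)
    {f : E → ℝ} (hf : Continuous f) {a b : E} (ha : a ∈ s) (hb : b ∈ s) {c : ℝ} (hac : f a < c)
    (hcb : c < f b) : ∃ x ∈ interior s, f x = c := by
  have hcl := subset_closure_interior hs hint
  obtain ⟨a', ha', ha'int⟩ := mem_closure_iff.1 (hcl ha) _ (isOpen_lt hf continuous_const) hac
  obtain ⟨b', hb', hb'int⟩ := mem_closure_iff.1 (hcl hb) _ (isOpen_lt continuous_const hf) hcb
  exact hs.interior.isPreconnected.intermediate_value ha'int hb'int hf.continuousOn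
    ⟨ha'.le, hb'.le⟩

theorem exists_ne_mem_interior_apply_eq [FiniteDimensional ℝ E] (hdim : 1 < Module.finrank ℝ E)
    {s : Set E} (hs : Convex ℝ s) (hint : (interior s).Nonempty) (f : E →ₗ[ℝ] ℝ) {a b : E}
    (ha : a ∈ s) (hb : b ∈ s) {v : E} (hav : f a < f v) (hvb : f v < f b) :
    ∃ x ∈ interior s, f x = f v ∧ x ≠ v := by
  obtain ⟨x, hx, hfx⟩ := exists_mem_interior_apply_eq hs hint f.continuous_of_finiteDimensional
    ha hb hav hvb
  obtain ⟨w, hw, hw0⟩ := (Submodule.ne_bot_iff _).1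
    (LinearMap.ker_ne_bot_of_finrank_lt (f := f) (by simpa using hdim))
  rcases ne_or_eq x v with hne | rfl
  · exact ⟨x, hx, hfx, hne⟩
  have hopen : IsOpen ((fun ε : ℝ => x + ε • w) ⁻¹' interior s) :=
    isOpen_interior.preimage (by fun_prop)
  obtain ⟨ε, hε, hε0⟩ := (hopen.mem_nhds (x := 0) (by simpa using hx) |>
    (dense_compl_singleton (0 : ℝ)).inter_nhds_nonempty)
  exact ⟨x + ε • w, hε0, by simp [LinearMap.mem_ker.1 hw], by simpa [hw0] using hε⟩

theorem exists_mem_face_of_mem_closure {L : SimplicialComplex ℝ E} (hfin : L.faces.Finite)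
    {A : Set E} (hA : A ⊆ L.space) {v : E} (hv : v ∈ L.vertices) (hvA : v ∈ closure A) :
    ∃ D ∈ L.faces, v ∈ D ∧ (A ∩ convexHull ℝ (D : Set E)).Nonempty := by
  have hcover : A = ⋃ D ∈ L.faces, A ∩ convexHull ℝ (D : Set E) := by
    rw [← inter_iUnion₂]
    exact (inter_eq_left.2 hA).symm
  rw [hcover, hfin.closure_biUnion] at hvA
  obtain ⟨D, hD, hvD⟩ := mem_iUnion₂.1 hvA
  have hclosed : IsClosed (convexHull ℝ (D : Set E)) :=
    (D.finite_toSet.isCompact_convexHull ℝ).isClosed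
  exact ⟨D, hD, (L.vertex_mem_convexHull_iff hv hD).1
    (closure_minimal inter_subset_right hclosed hvD), closure_nonempty_iff.1 ⟨v, hvD⟩⟩

theorem subset_of_nonempty_interior_inter {K : SimplicialComplex ℝ E} {s t : Finset E}
    (hs : s ∈ K.faces) (ht : t ∈ K.faces)
    (h : (interior (convexHull ℝ (s : Set E)) ∩ interior (convexHull ℝ (t : Set E))).Nonempty) :
    s ⊆ t := by
  intro v hv
  have hspan : affineSpan ℝ ((↑) '' {x : s | x.1 ∈ t} : Set E) = ⊤ := by
    refine affineSpan_eq_top_of_nonempty_interior (h.mono ?_)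
    rw [← interior_inter, K.convexHull_inter_convexHull hs ht]
    exact interior_mono (convexHull_mono fun x hx => ⟨⟨x, hx.1⟩, hx.2, rfl⟩)
  exact ((K.indep hs).mem_affineSpan_iff ⟨v, hv⟩ {x | x.1 ∈ t}).1
    (hspan ▸ AffineSubspace.mem_top ..)

theorem eq_of_nonempty_interior_inter {K : SimplicialComplex ℝ E} {s t : Finset E}
    (hs : s ∈ K.faces) (ht : t ∈ K.faces)
    (h : (interior (convexHull ℝ (s : Set E)) ∩ interior (convexHull ℝ (t : Set E))).Nonempty) :
    s = t :=
  (subset_of_nonempty_interior_inter hs ht h).antisymm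
    (subset_of_nonempty_interior_inter ht hs (by rwa [inter_comm]))

theorem subset_extremePoints_convexHull {s : Finset E} (hs : AffineIndependent ℝ ((↑) : s → E)) :
    (s : Set E) ⊆ (convexHull ℝ (s : Set E)).extremePoints ℝ := by
  intro v hv
  by_contra hext
  have hcompact := s.finite_toSet.isCompact_convexHull ℝ
  have hsub : (convexHull ℝ (s : Set E)).extremePoints ℝ ⊆ (s : Set E) \ {v} := fun y hy =>
    ⟨extremePoints_convexHull_subset hy, fun h => hext (h ▸ hy)⟩
  have hfin := s.finite_toSet.subset (hsub.trans sdiff_subset)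
  have hv' := subset_convexHull ℝ _ hv
  rw [← closure_convexHull_extremePoints hcompact (convex_convexHull ℝ _),
    (hfin.isCompact_convexHull ℝ).isClosed.closure_eq] at hv'
  refine hs.notMem_affineSpan_sdiff ⟨v, hv⟩ univ (convexHull_subset_affineSpan _ ?_)
  refine convexHull_mono (fun y hy => ?_) hv'
  exact ⟨⟨y, (hsub hy).1⟩, ⟨mem_univ _, fun h => (hsub hy).2 (congrArg Subtype.val h)⟩, rfl⟩

theorem vertices_subset_of_isSubdivision {K L : SimplicialComplex ℝ E} (hL : IsSubdivision L K) :
    K.vertices ⊆ L.vertices := by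
  intro v hv
  obtain ⟨D, hD, hvD⟩ := SimplicialComplex.mem_space_iff.1
    (hL.2.1.symm ▸ K.vertices_subset_space hv : v ∈ L.space)
  obtain ⟨T, hT, hDT⟩ := hL.2.2 D hD
  have hvT : v ∈ T := (K.vertex_mem_convexHull_iff hv hT).1 (hDT hvD)
  have hvext : v ∈ (convexHull ℝ (D : Set E)).extremePoints ℝ :=
    inter_extremePoints_subset_extremePoints_of_subset hDT
      ⟨hvD, subset_extremePoints_convexHull (K.indep hT) hvT⟩
  exact L.down_closed hD (Finset.singleton_subset_iff.2 (extremePoints_convexHull_subset hvext))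
    (Finset.singleton_nonempty v)

end Interior

section Median

variable {E : Type*} {f : E → ℝ} {D : Finset E} {v w : E}

/-- `v` is a median of `D` with respect to `f`: a point of `D` at which `f` takes neither its least
nor its greatest value on `D`. On the three vertices of a triangle there is exactly one such point
if `f` is injective. -/
def IsMedian (f : E → ℝ) (D : Finset E) (v : E) : Prop :=
  v ∈ D ∧ (∃ a ∈ D, f a < f v) ∧ ∃ b ∈ D, f v < f b

theorem exists_isMedian (hf : InjOn f D) (hD : D.card = 3) : ∃ v, IsMedian f D v := by
  classical
  have hne : D.Nonempty := Finset.card_pos.1 (by omega)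
  obtain ⟨a, ha, hmin⟩ := D.exists_min_image f hne
  obtain ⟨b, hb, hmax⟩ := D.exists_max_image f hne
  obtain ⟨v, hv⟩ : (D \ {a, b}).Nonempty := by
    rw [← Finset.card_pos]
    have := Finset.le_card_sdiff {a, b} D
    have := Finset.card_le_two (a := a) (b := b)
    omega
  simp only [Finset.mem_sdiff, Finset.mem_insert, Finset.mem_singleton, not_or] at hv
  obtain ⟨hv, hva, hvb⟩ := hv
  exact ⟨v, hv, ⟨a, ha, (hmin v hv).lt_of_ne fun h => hva (hf hv ha h.symm)⟩,
    b, hb, (hmax v hv).lt_of_ne fun h => hvb (hf hv hb h)⟩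

theorem IsMedian.eq (hf : InjOn f D) (hD : D.card = 3) (hv : IsMedian f D v)
    (hw : IsMedian f D w) : v = w := by
  classical
  by_contra hne
  wlog hlt : f v < f w generalizing v w
  · exact this hw hv (Ne.symm hne) ((not_lt.1 hlt).lt_of_ne fun h => hne (hf hv.1 hw.1 h.symm))
  obtain ⟨hvD, ⟨a, ha, hav⟩, -⟩ := hv
  obtain ⟨hwD, -, b, hb, hwb⟩ := hw
  have hsub : ({a, v, w, b} : Finset E) ⊆ D := by simp [Finset.insert_subset_iff, *]
  have hcard : ({a, v, w, b} : Finset E).card = 4 := by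
    rw [Finset.card_insert_of_notMem, Finset.card_insert_of_notMem, Finset.card_pair] <;> grind
  have := Finset.card_le_card hsub
  omega

theorem IsMedian.three_le_card (hv : IsMedian f D v) : 3 ≤ D.card := by
  classical
  obtain ⟨hvD, ⟨a, ha, hav⟩, b, hb, hvb⟩ := hv
  have hsub : ({a, v, b} : Finset E) ⊆ D := by simp [Finset.insert_subset_iff, *]
  rw [← Finset.card_eq_three.2 ⟨a, v, b, by grind, by grind, by grind, rfl⟩]
  exact Finset.card_le_card hsub

theorem isMedian_of_mem_convexHull [AddCommGroup E] [Module ℝ E] {f : E →ₗ[ℝ] ℝ} (hf : InjOn f D)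
    (hv : v ∈ D) {y : E} (hy : y ∈ convexHull ℝ (D : Set E)) (hyv : y ≠ v) (hfy : f y = f v) :
    IsMedian f D v := by
  refine ⟨hv, ?_, ?_⟩ <;> by_contra! hle
  · exact hyv (eq_of_mem_convexHull_of_apply_eq hf hv hle hy hfy)
  · exact hyv (eq_of_mem_convexHull_of_apply_eq (f := -f)
      (fun x hx z hz h => hf hx hz (neg_inj.1 h)) hv (fun x hx => neg_le_neg (hle x hx)) hy
      (congrArg Neg.neg hfy))

end Median

section Plane

variable {E : Type*} [NormedAddCommGroup E] [NormedSpace ℝ E] [hE : Fact (Module.finrank ℝ E = 2)]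

attribute [local instance] FiniteDimensional.of_fact_finrank_eq_two

theorem nonempty_interior_convexHull_of_card_eq_three {s : Finset E}
    (hs : AffineIndependent ℝ ((↑) : s → E)) (hcard : s.card = 3) :
    (interior (convexHull ℝ (s : Set E))).Nonempty := by
  have := hs.affineSpan_eq_top_iff_card_eq_finrank_add_one
  rw [interior_convexHull_nonempty_iff_affineSpan_eq_top]
  rwa [Subtype.range_coe, Fintype.card_coe, hE.out, eq_true hcard, iff_true] at this

theorem card_le_three {s : Finset E} (hs : AffineIndependent ℝ ((↑) : s → E)) : s.card ≤ 3 := by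
  have := hs.card_le_finrank_succ
  rw [Fintype.card_coe] at this
  have := Submodule.finrank_le (vectorSpan ℝ (range ((↑) : s → E)))
  have := hE.out
  omega

variable {K L : SimplicialComplex ℝ E}

theorem existsUnique_convexHull_subset (hL : IsSubdivision L K) {D : Finset E}
    (hD : D ∈ triangles L) :
    ∃! T, T ∈ triangles K ∧ convexHull ℝ (D : Set E) ⊆ convexHull ℝ (T : Set E) := by
  obtain ⟨T, hT, hDT⟩ := hL.2.2 D hD.1
  have hcard : D.card ≤ T.card := (L.indep hD.1).card_le_card_of_subset_affineSpan
    (((subset_convexHull ℝ _).trans hDT).trans (convexHull_subset_affineSpan _))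
  refine ⟨T, ⟨⟨hT, (card_le_three (K.indep hT)).antisymm (hD.2 ▸ hcard)⟩, hDT⟩, ?_⟩
  rintro T' ⟨hT', hDT'⟩
  refine eq_of_nonempty_interior_inter hT'.1 hT ?_
  exact (nonempty_interior_convexHull_of_card_eq_three (L.indep hD.1) hD.2).mono
    (subset_inter (interior_mono hDT') (interior_mono hDT))

theorem exists_triangle_isMedian (hL : IsSubdivision L K) {f : E →ₗ[ℝ] ℝ}
    (hf : InjOn f L.vertices) {T : Finset E} (hT : T ∈ triangles K) {v a b : E}
    (hv : v ∈ L.vertices) (hvT : v ∈ convexHull ℝ (T : Set E)) (ha : a ∈ T) (hb : b ∈ T)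
    (hav : f a < f v) (hvb : f v < f b) :
    ∃ D ∈ triangles L, convexHull ℝ (D : Set E) ⊆ convexHull ℝ (T : Set E) ∧ IsMedian f D v := by
  have hconv := convex_convexHull ℝ (T : Set E)
  obtain ⟨x, hx, hfx, hxv⟩ := exists_ne_mem_interior_apply_eq (by rw [hE.out]; exact one_lt_two)
    hconv (nonempty_interior_convexHull_of_card_eq_three (K.indep hT.1) hT.2) f
    (subset_convexHull ℝ _ ha) (subset_convexHull ℝ _ hb) hav hvb
  have hseg : openSegment ℝ v x ⊆ interior (convexHull ℝ (T : Set E)) :=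
    hconv.openSegment_self_interior_subset_interior hvT hx
  obtain ⟨D, hD, hvD, y, hy, hyD⟩ := exists_mem_face_of_mem_closure hL.1
    (hseg.trans (interior_subset.trans (hL.2.1.symm ▸ K.convexHull_subset_space hT.1)))
    hv (segment_subset_closure_openSegment (left_mem_segment ℝ v x))
  have hfy : f y = f v := by
    simpa [hfx] using (convex_singleton (f v)).linear_preimage f |>.openSegment_subset rfl hfx hy
  have hyv : y ≠ v := by
    rintro rfl
    exact hxv ((left_mem_openSegment_iff).1 hy).symm
  have hmed : IsMedian f D v :=
    isMedian_of_mem_convexHull (hf.mono (coe_subset_vertices hD)) hvD hyD hyv hfy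
  have hD' : D ∈ triangles L := ⟨hD, (card_le_three (L.indep hD)).antisymm hmed.three_le_card⟩
  obtain ⟨T', ⟨hT', hDT'⟩, -⟩ := existsUnique_convexHull_subset hL hD'
  obtain rfl : T = T' := by
    refine eq_of_nonempty_interior_inter hT.1 hT'.1 ?_
    have hint' := nonempty_interior_convexHull_of_card_eq_three (K.indep hT'.1) hT'.2
    rw [inter_comm]
    exact (closure_inter_open_nonempty_iff isOpen_interior).1
      ⟨y, subset_closure_interior (convex_convexHull ℝ _) hint' (hDT' hyD), hseg hy⟩
  exact ⟨D, hD', hDT', hmed⟩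

theorem exists_separating_functional {D D' : Finset E} (hD : D ∈ triangles L)
    (hD' : D' ∈ triangles L) (hne : D ≠ D') :
    ∃ (f : E →L[ℝ] ℝ) (u : ℝ), (∀ y ∈ D, f y ≤ u) ∧ (∀ y ∈ D', u ≤ f y) ∧
      (∃ x ∈ convexHull ℝ (D : Set E), f x < u) ∧ ∃ x ∈ convexHull ℝ (D' : Set E), u < f x := by
  have hconv := convex_convexHull ℝ (D : Set E)
  have hconv' := convex_convexHull ℝ (D' : Set E)
  have hint := nonempty_interior_convexHull_of_card_eq_three (L.indep hD.1) hD.2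
  have hint' := nonempty_interior_convexHull_of_card_eq_three (L.indep hD'.1) hD'.2
  obtain ⟨f, u, hfD, hfD'⟩ := geometric_hahn_banach_open_open hconv.interior isOpen_interior
    hconv'.interior isOpen_interior (not_not.1 fun h => hne <|
      eq_of_nonempty_interior_inter hD.1 hD'.1 (not_disjoint_iff_nonempty_inter.1 h))
  refine ⟨f, u, fun y hy => ?_, fun y hy => ?_, ?_, ?_⟩
  · exact closure_minimal (fun x hx => (hfD x hx).le) (isClosed_le f.continuous continuous_const)
      (subset_closure_interior hconv hint (subset_convexHull ℝ _ hy))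
  · exact closure_minimal (fun x hx => (hfD' x hx).le) (isClosed_le continuous_const f.continuous)
      (subset_closure_interior hconv' hint' (subset_convexHull ℝ _ hy))
  · exact hint.imp fun x hx => ⟨interior_subset hx, hfD x hx⟩
  · exact hint'.imp fun x hx => ⟨interior_subset hx, hfD' x hx⟩

theorem eq_of_edge_subset {T D D' e : Finset E} (hT : T.card = 3)
    (hD : D ∈ triangles L) (hD' : D' ∈ triangles L)
    (hDT : convexHull ℝ (D : Set E) ⊆ convexHull ℝ (T : Set E))
    (hDT' : convexHull ℝ (D' : Set E) ⊆ convexHull ℝ (T : Set E))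
    (he : e.card = 2) (heT : e ⊆ T) (heD : e ⊆ D) (heD' : e ⊆ D') : D = D' := by
  classical
  by_contra hne
  obtain ⟨f, u, hle, hge, ⟨x, hx, hfx⟩, x', hx', hfx'⟩ := exists_separating_functional hD hD' hne
  obtain ⟨d, hd⟩ : ∃ d, T \ e = {d} := by
    rw [← Finset.card_eq_one, Finset.card_sdiff_of_subset heT, hT, he]
  have hTd : ∀ y ∈ T, f y = u ∨ y = d := fun y hy => by
    by_cases hye : y ∈ e
    · exact Or.inl ((hle y (heD hye)).antisymm (hge y (heD' hye)))
    · exact Or.inr (Finset.mem_singleton.1 (hd ▸ Finset.mem_sdiff.2 ⟨hy, hye⟩))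
  rcases le_total (f d) u with hdu | hdu
  · have hTu : convexHull ℝ (T : Set E) ⊆ {y | f y ≤ u} := convexHull_min
      (fun y hy => (hTd y hy).elim le_of_eq fun h => h ▸ hdu)
      (convex_halfSpace_le f.toLinearMap.isLinear u)
    exact hfx'.not_ge (hTu (hDT' hx'))
  · have hTu : convexHull ℝ (T : Set E) ⊆ {y | u ≤ f y} := convexHull_min
      (fun y hy => (hTd y hy).elim ge_of_eq fun h => h ▸ hdu)
      (convex_halfSpace_ge f.toLinearMap.isLinear u)
    exact hfx.not_ge (hTu (hDT hx))

end Plane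

section Crossings

variable {X Y : Type*} {H : SimpleGraph X} {G : SimpleGraph Y} {s t : X} {p : H.Walk s t}

theorem exists_two_exits (hp : p.IsPath) {S : Set X} (hs : s ∈ S) (ht : t ∈ S) {z : X}
    (hz : z ∈ p.support) (hzS : z ∉ S) :
    ∃ x ∈ S, ∃ x' ∈ S, x ≠ x' ∧ (∃ y ∉ S, H.Adj x y) ∧ ∃ y ∉ S, H.Adj x' y := by
  classical
  obtain ⟨d, hd, hdS, hdS'⟩ := (p.takeUntil z hz).exists_boundary_dart S hs hzS
  obtain ⟨d', hd', hd'S, hd'S'⟩ := (p.dropUntil z hz).exists_boundary_dart Sᶜ hzS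
    (notMem_compl_iff.2 ht)
  refine ⟨d.fst, hdS, d'.snd, notMem_compl_iff.1 hd'S', ?_, ⟨d.snd, hdS', d.adj⟩,
    d'.fst, hd'S, d'.adj.symm⟩
  have hnodup := hp.support_nodup
  rw [← p.take_spec hz, SimpleGraph.Walk.support_append, List.nodup_append] at hnodup
  refine hnodup.2.2 _ ((p.takeUntil z hz).dart_fst_mem_support_of_mem_darts hd) _ ?_
  rw [← SimpleGraph.Walk.map_snd_darts]
  exact List.mem_map_of_mem hd'

theorem exists_two_crossings [DecidableEq X] {π : X → Y} (hsurj : Function.Surjective π)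
    (hπ : ∀ x y, H.Adj x y → π x = π y ∨ G.Adj (π x) (π y)) (hp : p.IsHamiltonian)
    {e : Sym2 Y} (he : G.IsBridge e) {w : G.Walk (π s) (π t)} (hw : e ∉ w.edges) :
    ∃ x x', x ≠ x' ∧ π x = π x' ∧
      (∃ y, H.Adj x y ∧ s(π x, π y) = e) ∧ ∃ y, H.Adj x' y ∧ s(π x', π y) = e := by
  set S : Set X := {x | (G.deleteEdges {e}).Reachable (π s) (π x)}
  have hcross : ∀ x ∈ S, ∀ y ∉ S, H.Adj x y → s(π x, π y) = e := by
    intro x hx y hy hxy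
    by_contra hne
    rcases hπ x y hxy with h | h
    · exact hy (show (G.deleteEdges {e}).Reachable _ _ from h ▸ hx)
    · exact hy (hx.trans (SimpleGraph.deleteEdges_adj.2 ⟨h, hne⟩).reachable)
  obtain ⟨b, hb⟩ : ∃ b, ¬ (G.deleteEdges {e}).Reachable (π s) b := by
    by_contra! hall
    induction e with
    | h a b => exact SimpleGraph.isBridge_iff.1 he ((hall a).symm.trans (hall b))
  obtain ⟨z, rfl⟩ := hsurj b
  obtain ⟨x, hx, x', hx', hne, ⟨y, hy, hxy⟩, y', hy', hxy'⟩ := exists_two_exits (S := S) hp.isPath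
    (SimpleGraph.Reachable.refl _) ⟨w.toDeleteEdge e hw⟩ (hp.mem_support z) hb
  have hex := hcross x hx y hy hxy
  have hex' := hcross x' hx' y' hy' hxy'
  refine ⟨x, x', hne, ?_, ⟨y, hxy, hex⟩, y', hxy', hex'⟩
  rcases Sym2.eq_iff.1 (hex.trans hex'.symm) with h | h
  · exact h.1
  · exact absurd hx (show ¬ (G.deleteEdges {e}).Reachable _ _ from h.1 ▸ hy')

theorem card_dart_le_of_mem_edges {u v : Y} {w : G.Walk u v} (D : Finset G.Dart)
    (hD : ∀ d ∈ D, d.edge ∈ w.edges) : D.card ≤ 2 * w.length := by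
  classical
  have hsub : D ⊆ w.darts.toFinset ∪ w.darts.toFinset.image SimpleGraph.Dart.symm := by
    intro d hd
    obtain ⟨d', hd', he⟩ := List.mem_map.1 (hD d hd)
    rw [Finset.mem_union, List.mem_toFinset, Finset.mem_image]
    rcases (SimpleGraph.dart_edge_eq_iff d d').1 he.symm with rfl | rfl
    · exact Or.inl hd'
    · exact Or.inr ⟨d', List.mem_toFinset.2 hd', rfl⟩
  calc D.card ≤ w.darts.toFinset.card + (w.darts.toFinset.image SimpleGraph.Dart.symm).card :=
        (Finset.card_le_card hsub).trans (Finset.card_union_le _ _)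
    _ ≤ w.darts.toFinset.card + w.darts.toFinset.card :=
        Nat.add_le_add_left Finset.card_image_le _
    _ ≤ w.darts.length + w.darts.length := by gcongr <;> exact w.darts.toFinset_card_le
    _ = 2 * w.length := by rw [SimpleGraph.Walk.length_darts, two_mul]

end Crossings

section DualGraph

variable {E : Type*} [AddCommGroup E] [Module ℝ E] {K L : SimplicialComplex ℝ E}

theorem dualGraph_adj_iff [DecidableEq E] {T T' : triangles K} :
    (dualGraph K).Adj T T' ↔ (T.1 ∩ T'.1).card = 2 := by
  have hT := T.2.2
  have hT' := T'.2.2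
  constructor
  · rintro ⟨hne, e, -, he, heT, heT'⟩
    have hle := Finset.card_le_card (Finset.subset_inter heT heT')
    refine le_antisymm (not_lt.1 fun hlt => hne (Subtype.ext ?_)) (he ▸ hle)
    rw [← Finset.eq_of_subset_of_card_le Finset.inter_subset_left (hT.trans_le hlt),
      Finset.eq_of_subset_of_card_le Finset.inter_subset_right (hT'.trans_le hlt)]
  · refine fun h => ⟨?_, _, K.down_closed T.2.1 Finset.inter_subset_left ?_, h,
      Finset.inter_subset_left, Finset.inter_subset_right⟩
    · rintro rfl
      rw [Finset.inter_self] at h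
      omega
    · exact Finset.card_pos.1 (by omega)

theorem inter_mem_faces [DecidableEq E] {T T' : triangles K} (h : (dualGraph K).Adj T T') :
    T.1 ∩ T'.1 ∈ K.faces :=
  K.down_closed T.2.1 Finset.inter_subset_left
    (Finset.card_pos.1 (by rw [dualGraph_adj_iff.1 h]; exact two_pos))

theorem eq_of_inter_eq [DecidableEq E] (hac : (dualGraph K).IsAcyclic) {T T₁ T₂ : triangles K}
    (h₁ : (dualGraph K).Adj T T₁) (h₂ : (dualGraph K).Adj T T₂) (h : T.1 ∩ T₁.1 = T.1 ∩ T₂.1) :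
    T₁ = T₂ := by
  by_contra hne
  have h₁₂ : (dualGraph K).Adj T₁ T₂ := ⟨hne, _, inter_mem_faces h₁, dualGraph_adj_iff.1 h₁,
    Finset.inter_subset_right, h ▸ Finset.inter_subset_right⟩
  exact hac.cliqueFree le_rfl {T, T₁, T₂} (SimpleGraph.is3Clique_triple_iff.2 ⟨h₁, h₂, h₁₂⟩)

/-- The edge `e` is split by the subdivision `L` if `L` has a vertex on `e` other than the ends
of `e`. -/
def IsSplit (L : SimplicialComplex ℝ E) (e : Finset E) : Prop :=
  ∃ v ∈ L.vertices, v ∈ convexHull ℝ (e : Set E) ∧ v ∉ e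

theorem eq_of_mem_convexHull_edges {e e' : Finset E} (he : e ∈ K.faces) (he' : e' ∈ K.faces)
    (hcard : e.card = 2) (hcard' : e'.card = 2) {v : E} (hv : v ∈ convexHull ℝ (e : Set E))
    (hv' : v ∈ convexHull ℝ (e' : Set E)) (hve : v ∉ e) : e = e' := by
  classical
  by_contra hne
  have hmem := K.inter_subset_convexHull he he' ⟨hv, hv'⟩
  rw [← Finset.coe_inter] at hmem
  refine hve (Finset.mem_of_mem_inter_left (mem_of_mem_convexHull_of_card_le_one ?_ hmem))
  by_contra! hlt
  refine hne ?_
  rw [← Finset.eq_of_subset_of_card_le (Finset.inter_subset_left (s₁ := e) (s₂ := e'))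
    (by omega), Finset.eq_of_subset_of_card_le Finset.inter_subset_right (by omega)]

end DualGraph

section Counting

variable {E : Type*} [NormedAddCommGroup E] [NormedSpace ℝ E] {K L : SimplicialComplex ℝ E}
  {f : E →ₗ[ℝ] ℝ}

theorem finite_triangles (hL : L.faces.Finite) : Finite (triangles L) :=
  (hL.subset fun _ h => h.1).to_subtype

theorem exists_linearMap_injOn_vertices (hL : L.faces.Finite) :
    ∃ f : E →ₗ[ℝ] ℝ, InjOn f L.vertices :=
  exists_linearMap_injOn (L.vertices_eq ▸ hL.biUnion fun s _ => s.finite_toSet)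

/-- The pairs of a triangle `T` of `K` and a vertex `v` of `L` on `T` at which `f` is neither least
nor greatest on `T`. In a subdivision `L` each of them is the median vertex of some triangle of `L`
in `T`. -/
def medianPairs (K L : SimplicialComplex ℝ E) (f : E → ℝ) : Set (triangles K × E) :=
  {q | q.2 ∈ L.vertices ∧ q.2 ∈ convexHull ℝ (q.1.1 : Set E) ∧
    (∃ a ∈ q.1.1, f a < f q.2) ∧ ∃ b ∈ q.1.1, f q.2 < f b}

theorem exists_vertex_mem_medianPairs (hL : IsSubdivision L K) (hf : InjOn f L.vertices)
    (T : triangles K) : ∃ v ∈ T.1, (T, v) ∈ medianPairs K L f := by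
  have hTL := (coe_subset_vertices T.2.1).trans (vertices_subset_of_isSubdivision hL)
  obtain ⟨v, hv, hlt, hgt⟩ := exists_isMedian (hf.mono hTL) T.2.2
  exact ⟨v, hv, hTL hv, subset_convexHull ℝ _ hv, hlt, hgt⟩

theorem mem_medianPairs_of_edge (hL : IsSubdivision L K) (hf : InjOn f L.vertices)
    {T : triangles K} {e : Finset E} (heT : e ⊆ T.1) {v : E} (hv : v ∈ L.vertices)
    (hve : v ∈ convexHull ℝ (e : Set E)) (hne : v ∉ e) : (T, v) ∈ medianPairs K L f := by
  have heL : (e : Set E) ⊆ L.vertices := (Finset.coe_subset.2 heT).trans <|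
    (coe_subset_vertices T.2.1).trans (vertices_subset_of_isSubdivision hL)
  have hfv : ∀ y ∈ (e : Set E), f y ≠ f v := fun y hy h => hne (hf (heL hy) hv h ▸ hy)
  obtain ⟨a, ha, hav⟩ := exists_apply_lt_of_mem_convexHull hve hfv
  obtain ⟨b, hb, hvb⟩ := exists_apply_lt_of_mem_convexHull (f := -f) hve
    fun y hy h => hfv y hy (neg_inj.1 h)
  exact ⟨hv, convexHull_mono (Finset.coe_subset.2 heT) hve, ⟨a, heT ha, hav⟩,
    b, heT hb, neg_lt_neg_iff.1 hvb⟩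

theorem nonempty_sum_embedding_medianPairs [DecidableEq E] (hL : IsSubdivision L K)
    (hf : InjOn f L.vertices) (hac : (dualGraph K).IsAcyclic) :
    Nonempty (triangles K ⊕ {d : (dualGraph K).Dart // IsSplit L (d.fst.1 ∩ d.snd.1)} ↪
      medianPairs K L f) := by
  choose v hvT hv using exists_vertex_mem_medianPairs hL hf
  choose u huL hue hune using fun d : {d : (dualGraph K).Dart // IsSplit L (d.fst.1 ∩ d.snd.1)} =>
    d.2
  have hu : ∀ d, (d.1.fst, u d) ∈ medianPairs K L f := fun d =>
    mem_medianPairs_of_edge hL hf Finset.inter_subset_left (huL d) (hue d) (hune d)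
  have huT : ∀ d, u d ∉ d.1.fst.1 := fun d hd => hune d <|
    (K.vertex_mem_convexHull_iff (coe_subset_vertices d.1.fst.2.1 hd)
      (inter_mem_faces d.1.adj)).1 (hue d)
  refine ⟨⟨Sum.elim (fun T => ⟨(T, v T), hv T⟩) fun d => ⟨(d.1.fst, u d), hu d⟩,
    Function.Injective.sumElim (fun T T' h => ?_) (fun d d' h => ?_) fun T d h => ?_⟩⟩
  · exact (Prod.ext_iff.1 (Subtype.ext_iff.1 h)).1
  · obtain ⟨hfst, hu'⟩ : d.1.fst = d'.1.fst ∧ u d = u d' := Prod.ext_iff.1 (Subtype.ext_iff.1 h)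
    have hedge := eq_of_mem_convexHull_edges (inter_mem_faces d.1.adj) (inter_mem_faces d'.1.adj)
      (dualGraph_adj_iff.1 d.1.adj) (dualGraph_adj_iff.1 d'.1.adj) (hue d) (hu' ▸ hue d') (hune d)
    rw [← hfst] at hedge
    have hsnd := eq_of_inter_eq hac d.1.adj (hfst ▸ d'.1.adj) hedge
    exact Subtype.ext (SimpleGraph.Dart.ext _ _ (Prod.ext hfst hsnd))
  · obtain ⟨hT, hu'⟩ : T = d.1.fst ∧ v T = u d := Prod.ext_iff.1 (Subtype.ext_iff.1 h)
    exact huT d (hT ▸ hu' ▸ hvT T)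

variable [Fact (Module.finrank ℝ E = 2)]

/-- The triangle of `K` in which a triangle of the subdivision `L` lies. -/
noncomputable def owner (hL : IsSubdivision L K) (D : triangles L) : triangles K :=
  ⟨(existsUnique_convexHull_subset hL D.2).choose,
    (existsUnique_convexHull_subset hL D.2).choose_spec.1.1⟩

theorem convexHull_subset_owner (hL : IsSubdivision L K) (D : triangles L) :
    convexHull ℝ (D.1 : Set E) ⊆ convexHull ℝ ((owner hL D).1 : Set E) :=
  (existsUnique_convexHull_subset hL D.2).choose_spec.1.2

theorem owner_eq (hL : IsSubdivision L K) {D : triangles L} {T : triangles K}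
    (h : convexHull ℝ (D.1 : Set E) ⊆ convexHull ℝ (T.1 : Set E)) : owner hL D = T :=
  Subtype.ext ((existsUnique_convexHull_subset hL D.2).choose_spec.2 T ⟨T.2, h⟩).symm

theorem exists_owner_eq_isMedian (hL : IsSubdivision L K) (hf : InjOn f L.vertices)
    {q : triangles K × E} (hq : q ∈ medianPairs K L f) :
    ∃ D : triangles L, owner hL D = q.1 ∧ IsMedian f D.1 q.2 := by
  obtain ⟨hv, hvT, ⟨a, ha, hav⟩, b, hb, hvb⟩ := hq
  obtain ⟨D, hD, hDT, hmed⟩ := exists_triangle_isMedian hL hf q.1.2 hv hvT ha hb hav hvb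
  exact ⟨⟨D, hD⟩, owner_eq hL hDT, hmed⟩

theorem nonempty_medianPairs_embedding (hL : IsSubdivision L K) (hf : InjOn f L.vertices) :
    Nonempty (medianPairs K L f ↪ triangles L) := by
  choose D howner hmed using fun q : medianPairs K L f => exists_owner_eq_isMedian hL hf q.2
  refine ⟨D, fun q q' h => Subtype.ext (Prod.ext ?_ ?_)⟩
  · rw [← howner q, h, howner q']
  · exact (hmed q).eq (hf.mono (coe_subset_vertices (D q).2.1)) (D q).2.2 (h ▸ hmed q')

theorem owner_surjective (hL : IsSubdivision L K) : Function.Surjective (owner hL) := by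
  intro T
  obtain ⟨f, hf⟩ := exists_linearMap_injOn_vertices hL.1
  obtain ⟨v, -, hv⟩ := exists_vertex_mem_medianPairs hL hf T
  exact (exists_owner_eq_isMedian hL hf hv).imp fun D hD => hD.1

theorem numTriangles_add_card_isSplit_le [DecidableEq E] (hL : IsSubdivision L K)
    (hac : (dualGraph K).IsAcyclic) :
    numTriangles K + Nat.card {d : (dualGraph K).Dart // IsSplit L (d.fst.1 ∩ d.snd.1)} ≤
      numTriangles L := by
  have := finite_triangles hL.1
  obtain ⟨f, hf⟩ := exists_linearMap_injOn_vertices hL.1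
  obtain ⟨i⟩ := nonempty_sum_embedding_medianPairs hL hf hac
  obtain ⟨j⟩ := nonempty_medianPairs_embedding hL hf
  have := Finite.of_surjective _ (owner_surjective hL)
  have := Finite.of_injective (fun d : (dualGraph K).Dart => d.toProd)
    SimpleGraph.Dart.toProd_injective
  rw [numTriangles, ← Nat.card_coe_set_eq, ← Nat.card_sum]
  exact Nat.card_le_card_of_injective _ (i.trans j).injective

theorem convexHull_inter_subset_owner [DecidableEq E] (hL : IsSubdivision L K) (x y : triangles L) :
    convexHull ℝ ((x.1 ∩ y.1 : Finset E) : Set E) ⊆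
      convexHull ℝ (((owner hL x).1 ∩ (owner hL y).1 : Finset E) : Set E) := by
  refine Subset.trans ?_ ((K.inter_subset_convexHull (owner hL x).2.1 (owner hL y).2.1).trans_eq
    (by rw [Finset.coe_inter]))
  rw [Finset.coe_inter]
  exact subset_inter
    ((convexHull_mono inter_subset_left).trans (convexHull_subset_owner hL x))
    ((convexHull_mono inter_subset_right).trans (convexHull_subset_owner hL y))

theorem owner_eq_or_adj (hL : IsSubdivision L K) {x y : triangles L}
    (h : (dualGraph L).Adj x y) :
    owner hL x = owner hL y ∨ (dualGraph K).Adj (owner hL x) (owner hL y) := by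
  classical
  have hle : (x.1 ∩ y.1).card ≤ ((owner hL x).1 ∩ (owner hL y).1).card :=
    (L.indep (inter_mem_faces h)).card_le_card_of_subset_affineSpan <|
      (subset_convexHull ℝ _).trans <| (convexHull_inter_subset_owner hL x y).trans
        (convexHull_subset_affineSpan _)
  rw [dualGraph_adj_iff.1 h] at hle
  refine or_iff_not_imp_left.2 fun hne => ?_
  obtain ⟨e, he, hcard⟩ := Finset.exists_subset_card_eq hle
  rw [Finset.subset_inter_iff] at he
  exact ⟨hne, e, K.down_closed (owner hL x).2.1 he.1 (Finset.card_pos.1 (by omega)), hcard, he⟩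

theorem subset_of_not_isSplit [DecidableEq E] (hL : IsSubdivision L K) {x y : triangles L}
    {e : Finset E} (hxy : (dualGraph L).Adj x y) (he : (owner hL x).1 ∩ (owner hL y).1 = e)
    (hcard : e.card = 2) (hsplit : ¬ IsSplit L e) : e ⊆ x.1 := by
  have hsub : x.1 ∩ y.1 ⊆ e := fun v hv => by_contra fun hve => hsplit
    ⟨v, coe_subset_vertices (inter_mem_faces hxy) hv,
      he ▸ convexHull_inter_subset_owner hL x y (subset_convexHull ℝ _ hv), hve⟩
  rw [← Finset.eq_of_subset_of_card_le hsub (hcard.trans (dualGraph_adj_iff.1 hxy).symm).le]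
  exact Finset.inter_subset_left

open Classical in
theorem mem_edges_of_not_isSplit (hL : IsSubdivision L K) (hac : (dualGraph K).IsAcyclic)
    {s t : triangles L} {p : (dualGraph L).Walk s t} (hp : IsSingleStrip L p)
    (w : (dualGraph K).Walk (owner hL s) (owner hL t)) {d : (dualGraph K).Dart}
    (hd : ¬ IsSplit L (d.fst.1 ∩ d.snd.1)) : d.edge ∈ w.edges := by
  by_contra hw
  obtain ⟨x, x', hne, howner, ⟨y, hxy, he⟩, y', hxy', he'⟩ := exists_two_crossings
    (owner_surjective hL) (fun _ _ => owner_eq_or_adj hL) hp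
    (SimpleGraph.isAcyclic_iff_forall_adj_isBridge.1 hac d.adj) hw
  have hinter : ∀ {T T' : triangles K}, s(T, T') = d.edge → T.1 ∩ T'.1 = d.fst.1 ∩ d.snd.1 := by
    rintro T T' h
    rcases Sym2.eq_iff.1 h with ⟨rfl, rfl⟩ | ⟨rfl, rfl⟩
    exacts [rfl, Finset.inter_comm _ _]
  have hcard := dualGraph_adj_iff.1 d.adj
  refine hne (Subtype.ext (eq_of_edge_subset (owner hL x).2.2 x.2 x'.2
    (convexHull_subset_owner hL x) (howner ▸ convexHull_subset_owner hL x') hcard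
    (hinter he ▸ Finset.inter_subset_left)
    (subset_of_not_isSplit hL hxy (hinter he) hcard hd)
    (subset_of_not_isSplit hL hxy' (hinter he') hcard hd)))

theorem three_mul_numTriangles_le (hL : IsSubdivision L K) (htree : (dualGraph K).IsTree) {m : ℕ}
    (hm : ∀ T T', (dualGraph K).dist T T' ≤ m) {s t : triangles L} {p : (dualGraph L).Walk s t}
    (hp : IsSingleStrip L p) : 3 * numTriangles K ≤ p.support.length + 2 * m + 2 := by
  classical
  have := finite_triangles hL.1
  have := Finite.of_surjective _ (owner_surjective hL)
  have := Fintype.ofFinite (triangles K)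
  have := Fintype.ofFinite (triangles L)
  obtain ⟨w, hw⟩ := htree.connected.exists_walk_length_eq_dist (owner hL s) (owner hL t)
  have hsplit := numTriangles_add_card_isSplit_le hL htree.isAcyclic
  have hunsplit := card_dart_le_of_mem_edges (w := w)
    {d : (dualGraph K).Dart | ¬ IsSplit L (d.fst.1 ∩ d.snd.1)}
    fun d hd => mem_edges_of_not_isSplit hL htree.isAcyclic hp w (Finset.mem_filter.1 hd).2
  have hdarts := Finset.card_filter_add_card_filter_not (s := Finset.univ)
    fun d : (dualGraph K).Dart => IsSplit L (d.fst.1 ∩ d.snd.1)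
  rw [Finset.card_univ, SimpleGraph.dart_card_eq_twice_card_edges] at hdarts
  have hedges := htree.card_edgeFinset
  have hlength : p.support.length = numTriangles L := by
    rw [hp.length_support, numTriangles, ← Nat.card_coe_set_eq, Nat.card_eq_fintype_card]
  rw [Nat.card_eq_fintype_card, Fintype.card_subtype] at hsplit
  rw [← Nat.card_eq_fintype_card, Nat.card_coe_set_eq, ← numTriangles] at hedges
  have := hm (owner hL s) (owner hL t)
  omega

end Counting

section Separation

variable {E : Type*} [AddCommGroup E] [Module ℝ E]

theorem convexHull_inter_subset_of_separated {s t u : Finset E} {g : E →ᵃ[ℝ] ℝ}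
    (hu : AffineIndependent ℝ ((↑) : u → E)) (hs : ∀ y ∈ s, 0 ≤ g y) (ht : ∀ y ∈ t, g y ≤ 0)
    (hsu : ∀ y ∈ s, g y = 0 → y ∈ u) (htu : ∀ y ∈ t, g y = 0 → y ∈ u) :
    convexHull ℝ (s : Set E) ∩ convexHull ℝ (t : Set E) ⊆ convexHull ℝ (s ∩ t : Set E) := by
  classical
  rintro x ⟨hxs, hxt⟩
  have hgx : g x = 0 := le_antisymm
    (convexHull_min ht ((convex_Iic (0 : ℝ)).affine_preimage g) hxt)
    (convexHull_min hs ((convex_Ici (0 : ℝ)).affine_preimage g) hxs)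
  have hxs₀ := mem_convexHull_zeros hs hxs hgx
  have hxt₀ := mem_convexHull_zeros (g := -g) (by simpa using ht) hxt (by simpa using hgx)
  simp only [Finset.mem_coe, ← Finset.coe_filter] at hxs₀ hxt₀
  have hx := (hu.convexHull_inter (by grind) (by simpa [Finset.subset_iff] using htu)).ge
    ⟨hxs₀, hxt₀⟩
  refine convexHull_mono ?_ hx
  exact Set.inter_subset_inter (Finset.filter_subset _ _) (Finset.filter_subset _ _)

theorem exists_mem_segment_apply_eq_zero {g : E →ᵃ[ℝ] ℝ} {x y : E} (hx : 0 ≤ g x)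
    (hy : g y ≤ 0) : ∃ z ∈ segment ℝ x y, g z = 0 := by
  have h : (0 : ℝ) ∈ g '' segment ℝ x y := by
    rw [image_segment, segment_symm, segment_eq_Icc (hy.trans hx)]
    exact ⟨hy, hx⟩
  exact h

theorem convexHull_insert_subset {S Z : Set E} {g : E →ᵃ[ℝ] ℝ} {v : E} (hZ : Z ⊆ S)
    (hS : ∀ y ∈ S, g y ≤ 0) (hv : 0 < g v)
    (hchord : ∀ z ∈ convexHull ℝ (insert v S), g z = 0 → z ∈ convexHull ℝ Z) :
    convexHull ℝ (insert v S) ⊆ convexHull ℝ S ∪ convexHull ℝ (insert v Z) := by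
  intro x hx
  rcases S.eq_empty_or_nonempty with rfl | hne
  · exact Or.inr (convexHull_mono (Set.insert_subset_insert (Set.empty_subset Z)) hx)
  have hxv := hx
  rw [convexHull_insert hne, convexJoin_singleton_left] at hxv
  obtain ⟨y, hy, hxy⟩ := Set.mem_iUnion₂.1 hxv
  have hyS := convexHull_mono (Set.subset_insert v S) hy
  have hgy : g y ≤ 0 := convexHull_min hS ((convex_Iic (0 : ℝ)).affine_preimage g) hy
  rw [mem_segment_iff_wbtw] at hxy
  rcases le_total (g x) 0 with hgx | hgx
  · obtain ⟨z, hz, hgz⟩ := exists_mem_segment_apply_eq_zero hv.le hgx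
    have hzZ := hchord z ((convex_convexHull ℝ _).segment_subset
      (subset_convexHull ℝ _ (Set.mem_insert v S)) hx hz) hgz
    have hzxy := hxy.trans_left_right (mem_segment_iff_wbtw.1 hz)
    exact Or.inl ((convex_convexHull ℝ S).segment_subset (convexHull_mono hZ hzZ) hy
      (mem_segment_iff_wbtw.2 hzxy))
  · obtain ⟨z, hz, hgz⟩ := exists_mem_segment_apply_eq_zero hgx hgy
    have hzZ := hchord z ((convex_convexHull ℝ _).segment_subset hx hyS hz) hgz
    have hvxz := hxy.trans_right_left (mem_segment_iff_wbtw.1 hz)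
    exact Or.inr ((convex_convexHull ℝ _).segment_subset
      (subset_convexHull ℝ _ (Set.mem_insert v Z)) (convexHull_mono (Set.subset_insert v Z) hzZ)
      (mem_segment_iff_wbtw.2 hvxz))

theorem convexHull_union_image_subset {ι : Type*} {I : Finset ι} {S : Set E} {v : ι → E}
    {Z : ι → Set E} {g : ι → E →ᵃ[ℝ] ℝ} (hZ : ∀ i ∈ I, Z i ⊆ S)
    (hS : ∀ i ∈ I, ∀ y ∈ S, g i y ≤ 0) (hpos : ∀ i ∈ I, 0 < g i (v i))
    (hnonpos : ∀ i ∈ I, ∀ j ∈ I, j ≠ i → g i (v j) ≤ 0)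
    (hchord : ∀ i ∈ I, ∀ z ∈ convexHull ℝ (S ∪ v '' I), g i z = 0 → z ∈ convexHull ℝ (Z i)) :
    convexHull ℝ (S ∪ v '' I) ⊆ convexHull ℝ S ∪ ⋃ i ∈ I, convexHull ℝ (insert (v i) (Z i)) := by
  classical
  induction I using Finset.induction_on with
  | empty => simp
  | insert i I hi ih =>
    rw [Finset.coe_insert, Set.image_insert_eq, Set.union_insert] at hchord ⊢
    simp only [Finset.forall_mem_insert] at hZ hS hpos hnonpos hchord
    refine (convexHull_insert_subset (hZ.1.trans Set.subset_union_left) ?_ hpos.1 hchord.1).trans ?_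
    · rintro y (hy | ⟨j, hj, rfl⟩)
      · exact hS.1 y hy
      · exact hnonpos.1.2 j hj (ne_of_mem_of_not_mem hj hi)
    · have hI := ih hZ.2 hS.2 hpos.2 (fun j hj => (hnonpos.2 j hj).2) fun j hj z hz =>
        hchord.2 j hj z (convexHull_mono (Set.subset_insert _ _) hz)
      rw [Finset.set_biUnion_insert]
      exact (Set.union_subset_union_left _ hI).trans (by grind)

end Separation

section Chord

variable {E : Type*} [NormedAddCommGroup E] [InnerProductSpace ℝ E]

theorem collinear_of_apply_eq_zero (hE : Module.finrank ℝ E = 2) {g : E →ᵃ[ℝ] ℝ}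
    (hg : g.linear ≠ 0) {s : Set E} (hs : ∀ x ∈ s, g x = 0) : Collinear ℝ s := by
  have := Module.finite_of_finrank_eq_succ hE
  have hker : Module.finrank ℝ g.linear.ker = 1 := by
    have := Module.Dual.finrank_ker_add_one_of_ne_zero hg
    omega
  rw [collinear_iff_finrank_le_one, ← hker]
  refine Submodule.finrank_mono ?_
  rw [vectorSpan, Submodule.span_le]
  rintro _ ⟨x, hx, y, hy, rfl⟩
  rw [SetLike.mem_coe, LinearMap.mem_ker, g.linearMap_vsub, hs x hx, hs y hy, vsub_self]

theorem mem_segment_of_apply_eq_zero (hE : Module.finrank ℝ E = 2) {g : E →ᵃ[ℝ] ℝ}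
    (hg : g.linear ≠ 0) {a b x : E} (hab : a ≠ b) (ha : ‖a‖ = 1) (hb : ‖b‖ = 1) (hx : ‖x‖ ≤ 1)
    (hga : g a = 0) (hgb : g b = 0) (hgx : g x = 0) : x ∈ segment ℝ a b := by
  have hcol : Collinear ℝ {a, x, b} := collinear_of_apply_eq_zero hE hg (by simp [hga, hgb, hgx])
  exact mem_segment_iff_wbtw.2 (hcol.wbtw_of_dist_eq_of_dist_le (p := 0) (r := 1)
    (by simpa using ha) (by simpa using hx) (by simpa using hb) hab)

theorem affineIndependent_of_norm_eq_one_of_card_eq_three {t : Finset E}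
    (ht : ∀ x ∈ t, ‖x‖ = 1) (hcard : t.card = 3) : AffineIndependent ℝ ((↑) : t → E) := by
  have hsph : EuclideanGeometry.Cospherical (t : Set E) := ⟨0, 1, by simpa using ht⟩
  let e := (Finset.equivFinOfCardEq hcard).symm
  exact (affineIndependent_equiv e).1 (hsph.affineIndependent (by simp)
    (Subtype.val_injective.comp e.injective))

end Chord

local notation "Plane" => EuclideanSpace ℝ (Fin 2)

section PolygonVertex

theorem inner_polygonVertex (N i j : ℕ) :
    inner ℝ (polygonVertex N i) (polygonVertex N j) =
      Real.cos (2 * Real.pi * ((i : ℝ) - j) / N) := by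
  rw [mul_sub, sub_div, Real.cos_sub]
  simp [polygonVertex, PiLp.inner_apply, mul_comm]

@[simp]
theorem norm_polygonVertex (N i : ℕ) : ‖polygonVertex N i‖ = 1 := by
  rw [norm_eq_sqrt_real_inner, inner_polygonVertex]
  simp

theorem inner_polygonVertex_succ (N i : ℕ) :
    inner ℝ (polygonVertex N i) (polygonVertex N (i + 1)) = Real.cos (2 * Real.pi / N) := by
  rw [inner_polygonVertex, ← Real.cos_neg]
  congr 1
  push_cast
  ring

theorem polygonVertex_double (n i : ℕ) : polygonVertex (2 * n) (2 * i) = polygonVertex n i := by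
  have h : 2 * Real.pi * ((2 * i : ℕ) : ℝ) / ((2 * n : ℕ) : ℝ) = 2 * Real.pi * i / n := by
    push_cast
    rw [mul_left_comm]
    exact mul_div_mul_left _ _ two_ne_zero
  rw [polygonVertex, polygonVertex, h]

theorem polygonVertex_eq_iff {N : ℕ} (hN : N ≠ 0) (i j : ℕ) :
    polygonVertex N i = polygonVertex N j ↔ i ≡ j [MOD N] := by
  have hN' : (N : ℝ) ≠ 0 := Nat.cast_ne_zero.2 hN
  rw [← inner_eq_one_iff_of_norm_eq_one (𝕜 := ℝ) (norm_polygonVertex N i) (norm_polygonVertex N j),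
    inner_polygonVertex, Real.cos_eq_one_iff, Nat.ModEq.comm, ← Int.natCast_modEq_iff,
    Int.modEq_iff_dvd]
  refine exists_congr fun m => ?_
  rw [← @Int.cast_inj ℝ, eq_comm, div_eq_iff hN', mul_comm (m : ℝ),
    mul_assoc (2 * Real.pi), mul_right_inj' Real.two_pi_pos.ne', mul_comm (m : ℝ)]
  push_cast
  rfl

theorem polygonVertex_ne {N i j : ℕ} (hij : i < j) (hj : j < i + N) :
    polygonVertex N i ≠ polygonVertex N j := by
  rw [Ne, polygonVertex_eq_iff (by omega), Nat.modEq_iff_dvd' hij.le]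
  exact Nat.not_dvd_of_pos_of_lt (by omega) (by omega)

theorem polygonVertex_even_ne_odd {n : ℕ} (hn : n ≠ 0) (i j : ℕ) :
    polygonVertex (2 * n) (2 * i) ≠ polygonVertex (2 * n) (2 * j + 1) := by
  rw [Ne, polygonVertex_eq_iff (by omega)]
  intro h
  have : 2 * i % 2 = (2 * j + 1) % 2 := h.of_dvd (Dvd.intro n rfl)
  omega

/-- The set of vertices of the regular `N`-gon. -/
def polygonVertices (N : ℕ) : Set Plane :=
  Set.range fun i : Fin N => polygonVertex N i

theorem polygonVertex_mem {N : ℕ} (hN : N ≠ 0) (i : ℕ) : polygonVertex N i ∈ polygonVertices N :=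
  ⟨⟨i % N, Nat.mod_lt _ (Nat.pos_of_ne_zero hN)⟩,
    (polygonVertex_eq_iff hN _ _).2 (Nat.mod_modEq i N)⟩

theorem norm_eq_one_of_mem_polygonVertices {N : ℕ} {x : Plane} (hx : x ∈ polygonVertices N) :
    ‖x‖ = 1 := by
  obtain ⟨i, rfl⟩ := hx
  exact norm_polygonVertex N i

theorem convexHull_polygonVertices_subset_closedBall (N : ℕ) :
    convexHull ℝ (polygonVertices N) ⊆ Metric.closedBall (0 : Plane) 1 :=
  convexHull_min (fun _ hx => mem_closedBall_zero_iff.2 (norm_eq_one_of_mem_polygonVertices hx).le)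
    (convex_closedBall _ _)

theorem polygonVertices_double {n : ℕ} (hn : n ≠ 0) : polygonVertices (2 * n) =
    polygonVertices n ∪ (fun i => polygonVertex (2 * n) (2 * i + 1)) '' (Finset.range n) := by
  refine Set.Subset.antisymm ?_ (Set.union_subset ?_ ?_)
  · rintro _ ⟨⟨j, hj⟩, rfl⟩
    rcases Nat.even_or_odd' j with ⟨i, rfl | rfl⟩
    · exact Or.inl (by simpa only [polygonVertex_double] using polygonVertex_mem hn i)
    · exact Or.inr ⟨i, Finset.mem_coe.2 (Finset.mem_range.2 (by omega)), rfl⟩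
  · rintro _ ⟨i, rfl⟩
    simpa only [← polygonVertex_double n i] using polygonVertex_mem (by omega) _
  · rintro _ ⟨i, -, rfl⟩
    exact polygonVertex_mem (by omega) _

theorem polygonVertices_subset_double {n : ℕ} (hn : n ≠ 0) :
    polygonVertices n ⊆ polygonVertices (2 * n) :=
  polygonVertices_double hn ▸ Set.subset_union_left

theorem polygonVertex_odd_notMem {n : ℕ} (hn : n ≠ 0) (i : ℕ) :
    polygonVertex (2 * n) (2 * i + 1) ∉ polygonVertices n := by
  rintro ⟨j, hj⟩
  exact polygonVertex_even_ne_odd hn j i (by rw [polygonVertex_double, ← hj])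

end PolygonVertex

section Cutoff

/-- The affine functional that vanishes at the two neighbours of the `m`-th vertex of the regular
`N`-gon and, for `3 ≤ N`, is positive at this vertex: its zero set is the line that cuts off
the vertex. -/
noncomputable def cutoff (N m : ℕ) : Plane →ᵃ[ℝ] ℝ :=
  (innerₗ Plane (polygonVertex N m)).toAffineMap -
    AffineMap.const ℝ Plane (Real.cos (2 * Real.pi / N))

theorem cutoff_apply (N m : ℕ) (x : Plane) :
    cutoff N m x = inner ℝ (polygonVertex N m) x - Real.cos (2 * Real.pi / N) := rfl

theorem linear_cutoff_ne_zero (N m : ℕ) : (cutoff N m).linear ≠ 0 := by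
  intro h
  have h1 : (cutoff N m).linear (polygonVertex N m) =
      inner ℝ (polygonVertex N m) (polygonVertex N m) := by simp [cutoff]
  rw [h, real_inner_self_eq_norm_sq, norm_polygonVertex] at h1
  simp at h1

theorem two_pi_div_pos {N : ℕ} (hN : N ≠ 0) : 0 < 2 * Real.pi / N := by
  positivity

theorem two_pi_div_lt_pi {N : ℕ} (hN : 3 ≤ N) : 2 * Real.pi / N < Real.pi := by
  have h3 : (3 : ℝ) ≤ N := by exact_mod_cast hN
  rw [div_lt_iff₀ (by linarith)]
  nlinarith [Real.pi_pos]

theorem cutoff_self_pos {N : ℕ} (hN : 3 ≤ N) (m : ℕ) : 0 < cutoff N m (polygonVertex N m) := by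
  rw [cutoff_apply, real_inner_self_eq_norm_sq, norm_polygonVertex, one_pow, sub_pos,
    ← Real.cos_zero]
  exact Real.cos_lt_cos_of_nonneg_of_le_pi le_rfl (two_pi_div_lt_pi hN).le
    (two_pi_div_pos (by omega))

theorem cutoff_left (N m : ℕ) : cutoff N (m + 1) (polygonVertex N m) = 0 := by
  rw [cutoff_apply, real_inner_comm, inner_polygonVertex_succ, sub_self]

theorem cutoff_right (N m : ℕ) : cutoff N (m + 1) (polygonVertex N (m + 2)) = 0 := by
  rw [cutoff_apply, inner_polygonVertex_succ, sub_self]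

theorem cos_lt_cos_of_lt_of_lt_two_pi_sub {δ θ : ℝ} (hδ : 0 ≤ δ) (h1 : δ < θ)
    (h2 : θ < 2 * Real.pi - δ) : Real.cos θ < Real.cos δ := by
  rcases le_total θ Real.pi with h | h
  · exact Real.cos_lt_cos_of_nonneg_of_le_pi hδ h h1
  · rw [← Real.cos_two_pi_sub]
    exact Real.cos_lt_cos_of_nonneg_of_le_pi hδ (by linarith) (by linarith)

theorem cos_two_pi_mul_div_lt {N d : ℕ} (hd : 1 < d) (hdN : d + 1 < N) :
    Real.cos (2 * Real.pi * d / N) < Real.cos (2 * Real.pi / N) := by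
  have hN : (0 : ℝ) < N := by exact_mod_cast (by omega : 0 < N)
  have hd' : (1 : ℝ) < d := by exact_mod_cast hd
  have hdN' : (d : ℝ) + 1 < N := by exact_mod_cast hdN
  refine cos_lt_cos_of_lt_of_lt_two_pi_sub (by positivity) ?_ ?_
  · rw [div_lt_div_iff_of_pos_right hN]
    nlinarith [Real.pi_pos]
  · rw [lt_sub_iff_add_lt, ← add_div, div_lt_iff₀ hN]
    nlinarith [Real.pi_pos]

theorem cutoff_neg {N m j : ℕ} (hm : m + 1 < N) (hj : j < N)
    (hself : polygonVertex N j ≠ polygonVertex N (m + 1))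
    (hleft : polygonVertex N j ≠ polygonVertex N m)
    (hright : polygonVertex N j ≠ polygonVertex N (m + 2)) :
    cutoff N (m + 1) (polygonVertex N j) < 0 := by
  have hj1 : j ≠ m + 1 := fun h => hself (by rw [h])
  have hj0 : j ≠ m := fun h => hleft (by rw [h])
  have hj2 : j ≠ m + 2 := fun h => hright (by rw [h])
  have hjN : j + N ≠ m + 2 := fun h => hright <| by
    rw [polygonVertex_eq_iff (by omega), ← h, Nat.ModEq, Nat.add_mod_right]
  rw [cutoff_apply, sub_neg, inner_polygonVertex]
  rcases le_total j (m + 1) with hle | hle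
  · rw [← Nat.cast_sub hle]
    exact cos_two_pi_mul_div_lt (by omega) (by omega)
  · rw [← neg_sub, mul_neg, neg_div, Real.cos_neg, ← Nat.cast_sub hle]
    exact cos_two_pi_mul_div_lt (by omega) (by omega)

theorem cutoff_nonpos {N m : ℕ} (hm : m + 1 < N) {x : Plane} (hx : x ∈ polygonVertices N)
    (hne : x ≠ polygonVertex N (m + 1)) :
    cutoff N (m + 1) x ≤ 0 ∧ (cutoff N (m + 1) x = 0 →
      x = polygonVertex N m ∨ x = polygonVertex N (m + 2)) := by
  obtain ⟨j, rfl⟩ := hx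
  by_cases hl : polygonVertex N j = polygonVertex N m
  · exact ⟨by simp only [hl, cutoff_left, le_refl], fun _ => Or.inl hl⟩
  by_cases hr : polygonVertex N j = polygonVertex N (m + 2)
  · exact ⟨by simp only [hr, cutoff_right, le_refl], fun _ => Or.inr hr⟩
  have hneg := cutoff_neg hm j.2 hne hl hr
  exact ⟨hneg.le, fun h => (hneg.ne h).elim⟩

theorem mem_segment_of_cutoff_eq_zero {N m : ℕ} (hN : 3 ≤ N) {x : Plane} (hx : ‖x‖ ≤ 1)
    (h : cutoff N (m + 1) x = 0) :
    x ∈ segment ℝ (polygonVertex N m) (polygonVertex N (m + 2)) :=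
  mem_segment_of_apply_eq_zero (by simp) (linear_cutoff_ne_zero N (m + 1))
    (polygonVertex_ne (by omega) (by omega)) (norm_polygonVertex _ _) (norm_polygonVertex _ _) hx
    (cutoff_left N m) (cutoff_right N m) h

end Cutoff

section OuterTriangle

/-- The triangle that cuts off the vertex number `2 * i + 1` of the regular `2 * n`-gon. -/
noncomputable def outerTriangle (n i : ℕ) : Finset Plane :=
  polygonTriangle (2 * n) (2 * i) (2 * i + 1) (2 * i + 2)

theorem mem_polygonTriangle {N a b c : ℕ} {x : Plane} : x ∈ polygonTriangle N a b c ↔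
    x = polygonVertex N a ∨ x = polygonVertex N b ∨ x = polygonVertex N c := by
  simp [polygonTriangle]

theorem convexHull_polygonVertices_double_subset {n : ℕ} (hn : 2 ≤ n) :
    convexHull ℝ (polygonVertices (2 * n)) ⊆
      convexHull ℝ (polygonVertices n) ∪ ⋃ i < n, convexHull ℝ (outerTriangle n i : Set Plane) := by
  have hn0 : n ≠ 0 := by omega
  rw [polygonVertices_double hn0]
  refine (convexHull_union_image_subset
    (Z := fun i => {polygonVertex (2 * n) (2 * i), polygonVertex (2 * n) (2 * i + 2)})
    (g := fun i => cutoff (2 * n) (2 * i + 1)) ?_ ?_ ?_ ?_ ?_).trans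
    (Set.union_subset_union_right _ ?_)
  · intro i _
    rw [Set.pair_subset_iff, ← mul_add_one, polygonVertex_double, polygonVertex_double]
    exact ⟨polygonVertex_mem hn0 _, polygonVertex_mem hn0 _⟩
  · intro i hi y hy
    rw [Finset.mem_range] at hi
    refine (cutoff_nonpos (by omega) (polygonVertices_subset_double hn0 hy) ?_).1
    rintro rfl
    exact polygonVertex_odd_notMem hn0 i hy
  · exact fun i _ => cutoff_self_pos (by omega) _
  · intro i hi j hj hne
    rw [Finset.mem_range] at hi hj
    refine (cutoff_nonpos (by omega) (polygonVertex_mem (by omega) _) ?_).1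
    rcases hne.lt_or_gt with h | h
    · exact polygonVertex_ne (by omega) (by omega)
    · exact (polygonVertex_ne (by omega) (by omega)).symm
  · intro i _ z hz hgz
    rw [← polygonVertices_double hn0] at hz
    have hz1 := mem_closedBall_zero_iff.1 (convexHull_polygonVertices_subset_closedBall _ hz)
    rw [convexHull_pair]
    exact mem_segment_of_cutoff_eq_zero (by omega) hz1 hgz
  · refine Set.iUnion_mono fun i => Set.iUnion_mono' fun hi => ⟨Finset.mem_range.1 hi, ?_⟩
    refine convexHull_mono fun x hx => ?_
    rw [Finset.mem_coe, outerTriangle, mem_polygonTriangle]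
    simp only [Set.mem_insert_iff, Set.mem_singleton_iff] at hx
    tauto

theorem card_polygonTriangle {N m : ℕ} (hN : 3 ≤ N) :
    (polygonTriangle N m (m + 1) (m + 2)).card = 3 :=
  Finset.card_eq_three.2 ⟨_, _, _, polygonVertex_ne (by omega) (by omega),
    polygonVertex_ne (by omega) (by omega), polygonVertex_ne (by omega) (by omega), rfl⟩

theorem coe_polygonTriangle_subset {N : ℕ} (hN : N ≠ 0) (a b c : ℕ) :
    (polygonTriangle N a b c : Set Plane) ⊆ polygonVertices N := by
  intro x hx
  rcases mem_polygonTriangle.1 hx with rfl | rfl | rfl <;> exact polygonVertex_mem hN _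

theorem polygonVertex_odd_notMem_outerTriangle {n i j : ℕ} (hi : i < n) (hj : j < n)
    (hij : i ≠ j) : polygonVertex (2 * n) (2 * i + 1) ∉ outerTriangle n j := by
  rw [outerTriangle, mem_polygonTriangle]
  rintro (h | h | h)
  · exact polygonVertex_even_ne_odd (by omega) j i h.symm
  · rw [polygonVertex_eq_iff (by omega)] at h
    have := h.eq_of_lt_of_lt (by omega) (by omega)
    omega
  · exact polygonVertex_even_ne_odd (by omega) (j + 1) i h.symm

theorem convexHull_inter_subset_of_subset_outerTriangle {n i : ℕ} (hi : i < n) (hn : 2 ≤ n)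
    {s t : Finset Plane} (hs : s ⊆ outerTriangle n i)
    (ht : (t : Set Plane) ⊆ polygonVertices (2 * n))
    (hne : polygonVertex (2 * n) (2 * i + 1) ∉ t) :
    convexHull ℝ (s : Set Plane) ∩ convexHull ℝ (t : Set Plane) ⊆ convexHull ℝ (s ∩ t) := by
  have hpos := cutoff_self_pos (N := 2 * n) (by omega) (2 * i + 1)
  have hle := fun y (hy : y ∈ t) =>
    cutoff_nonpos (m := 2 * i) (by omega) (ht hy) (ne_of_mem_of_not_mem hy hne)
  have hnorm : ∀ x ∈ outerTriangle n i, ‖x‖ = 1 := fun x hx =>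
    norm_eq_one_of_mem_polygonVertices (coe_polygonTriangle_subset (by omega) _ _ _ hx)
  refine convexHull_inter_subset_of_separated (g := cutoff (2 * n) (2 * i + 1))
    (u := outerTriangle n i) (affineIndependent_of_norm_eq_one_of_card_eq_three hnorm
      (card_polygonTriangle (by omega))) ?_ (fun y hy => (hle y hy).1) (fun y hy _ => hs hy) ?_
  · intro y hy
    rcases mem_polygonTriangle.1 (hs hy) with rfl | rfl | rfl
    · rw [cutoff_left]
    · exact hpos.le
    · rw [cutoff_right]
  · intro y hy hgy
    exact mem_polygonTriangle.2 (((hle y hy).2 hgy).imp_right Or.inr)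

end OuterTriangle

section RecursiveModel

theorem three_le_three_mul_two_pow (k : ℕ) : 3 ≤ 3 * 2 ^ k :=
  Nat.le_mul_of_pos_right _ (by positivity)

theorem three_mul_two_pow_succ (k : ℕ) : 3 * 2 ^ (k + 1) = 2 * (3 * 2 ^ k) := by
  ring

theorem mem_recursiveTriangles_zero {T : Finset Plane} :
    T ∈ recursiveTriangles 0 ↔ T = polygonTriangle 3 0 1 2 := Iff.rfl

theorem mem_recursiveTriangles_succ {k : ℕ} {T : Finset Plane} :
    T ∈ recursiveTriangles (k + 1) ↔
      (∃ i < 3 * 2 ^ k, T = outerTriangle (3 * 2 ^ k) i) ∨ T ∈ recursiveTriangles k := by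
  simp only [outerTriangle, ← three_mul_two_pow_succ]
  rfl

theorem coe_subset_polygonVertices {k : ℕ} {T : Finset Plane} (hT : T ∈ recursiveTriangles k) :
    (T : Set Plane) ⊆ polygonVertices (3 * 2 ^ k) := by
  induction k with
  | zero =>
    rw [mem_recursiveTriangles_zero.1 hT]
    exact coe_polygonTriangle_subset (by norm_num) _ _ _
  | succ k ih =>
    have hk := three_le_three_mul_two_pow k
    rw [three_mul_two_pow_succ]
    rcases mem_recursiveTriangles_succ.1 hT with ⟨i, -, rfl⟩ | hT
    · exact coe_polygonTriangle_subset (by omega) _ _ _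
    · exact (ih hT).trans (polygonVertices_subset_double (by omega))

theorem card_of_mem_recursiveTriangles {k : ℕ} {T : Finset Plane}
    (hT : T ∈ recursiveTriangles k) : T.card = 3 := by
  induction k with
  | zero =>
    rw [mem_recursiveTriangles_zero.1 hT]
    exact card_polygonTriangle le_rfl
  | succ k ih =>
    have hk := three_le_three_mul_two_pow k
    rcases mem_recursiveTriangles_succ.1 hT with ⟨i, -, rfl⟩ | hT
    · exact card_polygonTriangle (by omega)
    · exact ih hT

theorem affineIndependent_of_mem_recursiveTriangles {k : ℕ} {T : Finset Plane}
    (hT : T ∈ recursiveTriangles k) : AffineIndependent ℝ ((↑) : T → Plane) :=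
  affineIndependent_of_norm_eq_one_of_card_eq_three
    (fun _ hx => norm_eq_one_of_mem_polygonVertices (coe_subset_polygonVertices hT hx))
    (card_of_mem_recursiveTriangles hT)

theorem convexHull_inter_subset_of_subset_of_mem {k : ℕ} {T T' s t : Finset Plane}
    (hT : T ∈ recursiveTriangles k) (hT' : T' ∈ recursiveTriangles k) (hs : s ⊆ T) (ht : t ⊆ T') :
    convexHull ℝ (s : Set Plane) ∩ convexHull ℝ (t : Set Plane) ⊆ convexHull ℝ (s ∩ t) := by
  rcases eq_or_ne T T' with rfl | hne
  · exact ((affineIndependent_of_mem_recursiveTriangles hT).convexHull_inter hs ht).ge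
  induction k generalizing T T' s t with
  | zero => exact (hne (hT.trans hT'.symm)).elim
  | succ k ih =>
    have hk := three_le_three_mul_two_pow k
    have hsV := (Finset.coe_subset.2 hs).trans (coe_subset_polygonVertices hT)
    have htV := (Finset.coe_subset.2 ht).trans (coe_subset_polygonVertices hT')
    rw [three_mul_two_pow_succ] at hsV htV
    rcases mem_recursiveTriangles_succ.1 hT with ⟨i, hi, rfl⟩ | hT <;>
      rcases mem_recursiveTriangles_succ.1 hT' with ⟨j, hj, rfl⟩ | hT'
    · refine convexHull_inter_subset_of_subset_outerTriangle hi (by omega) hs htV fun h => ?_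
      exact polygonVertex_odd_notMem_outerTriangle hi hj (fun hij => hne (hij ▸ rfl)) (ht h)
    · refine convexHull_inter_subset_of_subset_outerTriangle hi (by omega) hs htV fun h => ?_
      exact polygonVertex_odd_notMem (by omega) i (coe_subset_polygonVertices hT' (ht h))
    · rw [Set.inter_comm, Set.inter_comm (s : Set Plane)]
      refine convexHull_inter_subset_of_subset_outerTriangle hj (by omega) ht hsV fun h => ?_
      exact polygonVertex_odd_notMem (by omega) j (coe_subset_polygonVertices hT (hs h))
    · exact ih hT hT' hs ht hne

/-- The recursive triangulation of the regular `3 * 2 ^ k`-gon. -/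
def recursiveModel (k : ℕ) : SimplicialComplex ℝ Plane where
  faces := {s | s.Nonempty ∧ ∃ T ∈ recursiveTriangles k, s ⊆ T}
  isRelLowerSet_faces := fun _ hs =>
    ⟨hs.1, fun _ hts ht => ⟨ht, hs.2.imp fun _ hT => ⟨hT.1, hts.trans hT.2⟩⟩⟩
  indep := by
    rintro s ⟨-, T, hT, hs⟩
    exact (affineIndependent_of_mem_recursiveTriangles hT).mono (Finset.coe_subset.2 hs)
  inter_subset_convexHull := by
    rintro s t ⟨-, T, hT, hs⟩ ⟨-, T', hT', ht⟩
    exact convexHull_inter_subset_of_subset_of_mem hT hT' hs ht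

theorem mem_faces_recursiveModel {k : ℕ} {T : Finset Plane} (hT : T ∈ recursiveTriangles k) :
    T ∈ (recursiveModel k).faces :=
  ⟨Finset.card_pos.1 (by rw [card_of_mem_recursiveTriangles hT]; norm_num), T, hT, subset_rfl⟩

theorem triangles_recursiveModel (k : ℕ) :
    triangles (recursiveModel k) = recursiveTriangles k := by
  ext T
  constructor
  · rintro ⟨⟨-, T', hT', h⟩, h3⟩
    rwa [Finset.eq_of_subset_of_card_le h (by rw [h3, card_of_mem_recursiveTriangles hT'])]
  · exact fun hT => ⟨mem_faces_recursiveModel hT, card_of_mem_recursiveTriangles hT⟩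

theorem finite_recursiveTriangles (k : ℕ) : (recursiveTriangles k).Finite := by
  induction k with
  | zero => exact Set.finite_singleton _
  | succ k ih =>
    refine Set.Finite.union (((Set.finite_Iio (3 * 2 ^ k)).image fun i =>
      polygonTriangle (3 * 2 ^ (k + 1)) (2 * i) (2 * i + 1) (2 * i + 2)).subset ?_) ih
    rintro _ ⟨i, hi, rfl⟩
    exact ⟨i, hi, rfl⟩

theorem nonempty_recursiveTriangles (k : ℕ) : (recursiveTriangles k).Nonempty := by
  induction k with
  | zero => exact ⟨_, rfl⟩
  | succ k ih => exact ih.mono Set.subset_union_right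

theorem isTriangulatedModel_recursiveModel (k : ℕ) : IsTriangulatedModel (recursiveModel k) := by
  refine ⟨?_, ?_, ?_⟩
  · refine ((finite_recursiveTriangles k).biUnion fun T _ => T.powerset.finite_toSet).subset ?_
    rintro s ⟨-, T, hT, hs⟩
    exact Set.mem_biUnion hT (Finset.mem_coe.2 (Finset.mem_powerset.2 hs))
  · exact (nonempty_recursiveTriangles k).mono fun T hT => mem_faces_recursiveModel hT
  · rintro s ⟨-, T, hT, hs⟩
    exact ⟨T, (triangles_recursiveModel k).symm ▸ hT, hs⟩

theorem polygonVertices_three : polygonVertices 3 = polygonTriangle 3 0 1 2 := by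
  ext x
  rw [Finset.mem_coe, mem_polygonTriangle]
  simp [polygonVertices, Fin.exists_fin_succ, eq_comm]

theorem biUnion_recursiveTriangles (k : ℕ) :
    ⋃ T ∈ recursiveTriangles k, convexHull ℝ (T : Set Plane) =
      convexHull ℝ (polygonVertices (3 * 2 ^ k)) := by
  refine Set.Subset.antisymm
    (Set.iUnion₂_subset fun T hT => convexHull_mono (coe_subset_polygonVertices hT)) ?_
  induction k with
  | zero =>
    rw [pow_zero, mul_one, polygonVertices_three]
    exact Set.subset_biUnion_of_mem (u := fun T : Finset Plane => convexHull ℝ (T : Set Plane))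
      (mem_recursiveTriangles_zero.2 rfl)
  | succ k ih =>
    have hk := three_le_three_mul_two_pow k
    rw [three_mul_two_pow_succ]
    refine (convexHull_polygonVertices_double_subset (by omega)).trans
      (Set.union_subset (ih.trans (Set.biUnion_subset_biUnion_left Set.subset_union_right))
        (Set.iUnion₂_subset fun i hi => ?_))
    exact Set.subset_biUnion_of_mem (u := fun T : Finset Plane => convexHull ℝ (T : Set Plane))
      (mem_recursiveTriangles_succ.2 (Or.inl ⟨i, hi, rfl⟩))

theorem space_recursiveModel (k : ℕ) :
    (recursiveModel k).space = convexHull ℝ (polygonVertices (3 * 2 ^ k)) := by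
  rw [← biUnion_recursiveTriangles]
  refine Set.Subset.antisymm (Set.iUnion₂_subset ?_) (Set.iUnion₂_subset ?_)
  · rintro s ⟨-, T, hT, hs⟩
    exact (convexHull_mono (Finset.coe_subset.2 hs)).trans
      (Set.subset_biUnion_of_mem (u := fun T : Finset Plane => convexHull ℝ (T : Set Plane)) hT)
  · exact fun T hT => SimplicialComplex.convexHull_subset_space (mem_faces_recursiveModel hT)

end RecursiveModel

section Hemisphere

theorem mem_sphereWithHole {y : EuclideanSpace ℝ (Fin 3)} :
    y ∈ sphereWithHole ↔ y 0 ^ 2 + y 1 ^ 2 + y 2 ^ 2 = 1 ∧ y 2 ≤ 0 := by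
  have h : ‖y‖ = 1 ↔ y 0 ^ 2 + y 1 ^ 2 + y 2 ^ 2 = 1 := by
    rw [← pow_eq_one_iff_of_nonneg (norm_nonneg y) two_ne_zero, EuclideanSpace.real_norm_sq_eq,
      Fin.sum_univ_three]
  rw [← h]
  rfl

theorem mem_closedBall_plane {x : Plane} :
    x ∈ Metric.closedBall (0 : Plane) 1 ↔ x 0 ^ 2 + x 1 ^ 2 ≤ 1 := by
  rw [mem_closedBall_zero_iff, ← sq_le_one_iff₀ (norm_nonneg _), EuclideanSpace.real_norm_sq_eq,
    Fin.sum_univ_two]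

/-- The disc and the lower hemisphere are homeomorphic through the vertical projection. -/
noncomputable def discHomeomorphSphereWithHole :
    Metric.closedBall (0 : Plane) 1 ≃ₜ sphereWithHole where
  toFun x := ⟨!₂[x.1 0, x.1 1, -√(1 - x.1 0 ^ 2 - x.1 1 ^ 2)], by
    have hx := mem_closedBall_plane.1 x.2
    have hsq := Real.sq_sqrt (show 0 ≤ 1 - x.1 0 ^ 2 - x.1 1 ^ 2 by linarith)
    rw [mem_sphereWithHole]
    simp only [Matrix.cons_val]
    exact ⟨by rw [neg_sq, hsq]; ring, neg_nonpos.2 (Real.sqrt_nonneg _)⟩⟩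
  invFun y := ⟨!₂[y.1 0, y.1 1], by
    have hy := (mem_sphereWithHole.1 y.2).1
    rw [mem_closedBall_plane]
    simp only [Matrix.cons_val]
    linarith [sq_nonneg (y.1 2)]⟩
  left_inv x := by
    apply Subtype.ext
    ext i
    fin_cases i <;> rfl
  right_inv y := by
    obtain ⟨hy, hy'⟩ := mem_sphereWithHole.1 y.2
    have hsqrt : -√(1 - y.1 0 ^ 2 - y.1 1 ^ 2) = y.1 2 := by
      rw [show 1 - y.1 0 ^ 2 - y.1 1 ^ 2 = (-y.1 2) ^ 2 by linarith,
        Real.sqrt_sq (neg_nonneg.2 hy'), neg_neg]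
    apply Subtype.ext
    ext i
    fin_cases i
    exacts [rfl, rfl, hsqrt]
  continuous_toFun := by fun_prop
  continuous_invFun := by fun_prop

theorem nonempty_interior_convexHull_polygonVertices (k : ℕ) :
    (interior (convexHull ℝ (polygonVertices (3 * 2 ^ k)))).Nonempty := by
  obtain ⟨T, hT⟩ := nonempty_recursiveTriangles k
  refine Set.Nonempty.mono (interior_mono (convexHull_mono (coe_subset_polygonVertices hT))) ?_
  rw [interior_convexHull_nonempty_iff_affineSpan_eq_top]
  have := (affineIndependent_of_mem_recursiveTriangles
    hT).affineSpan_eq_top_iff_card_eq_finrank_add_one.2 (by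
      simp [card_of_mem_recursiveTriangles hT])
  simpa using this

theorem nonempty_homeomorph_sphereWithHole (k : ℕ) :
    Nonempty ((recursiveModel k).space ≃ₜ sphereWithHole) := by
  rw [space_recursiveModel]
  have hcpt : IsCompact (convexHull ℝ (polygonVertices (3 * 2 ^ k))) :=
    (Set.finite_range _).isCompact_convexHull ℝ
  obtain ⟨h, -, hcl, -⟩ := exists_homeomorph_image_interior_closure_frontier_eq_unitBall
    (convex_convexHull ℝ _) (nonempty_interior_convexHull_polygonVertices k) hcpt.isBounded
  rw [hcpt.isClosed.closure_eq] at hcl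
  exact ⟨((h.image _).trans (Homeomorph.setCongr hcl)).trans discHomeomorphSphereWithHole⟩

end Hemisphere

section RootedTree

variable {V W : Type*} {G : SimpleGraph V} {H : SimpleGraph W}

/-- `IsParentRel G depth P r` says that `G` is a tree with root `r`, in which `P u v` means that
`v` is the parent of `u`, and in which `depth` is the distance from the root. -/
structure IsParentRel (G : SimpleGraph V) (depth : V → ℕ) (P : V → V → Prop) (r : V) : Prop where
  depth_root : depth r = 0
  depth_eq : ∀ ⦃u v⦄, P u v → depth u = depth v + 1
  existsUnique_parent : ∀ u, u ≠ r → ∃! v, P u v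
  adj_iff : ∀ u v, G.Adj u v ↔ P u v ∨ P v u

namespace IsParentRel

variable {depth : V → ℕ} {P : V → V → Prop} {r : V}

theorem exists_walk (h : IsParentRel G depth P r) (v : V) :
    ∃ w : G.Walk r v, w.length = depth v := by
  induction hn : depth v generalizing v with
  | zero =>
    obtain rfl : v = r := by
      by_contra hv
      obtain ⟨u, hu, -⟩ := h.existsUnique_parent v hv
      have := h.depth_eq hu
      omega
    exact ⟨.nil, rfl⟩
  | succ n ih =>
    have hv : v ≠ r := by
      rintro rfl
      rw [h.depth_root] at hn
      omega
    obtain ⟨u, hu, -⟩ := h.existsUnique_parent v hv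
    obtain ⟨w, hw⟩ := ih u (by have := h.depth_eq hu; omega)
    exact ⟨w.concat ((h.adj_iff u v).2 (Or.inr hu)), by rw [SimpleGraph.Walk.length_concat, hw]⟩

theorem connected (h : IsParentRel G depth P r) : G.Connected := by
  rw [SimpleGraph.connected_iff_exists_forall_reachable]
  exact ⟨r, fun v => (h.exists_walk v).choose.reachable⟩

theorem depth_le_add_length (h : IsParentRel G depth P r) {u v : V} (w : G.Walk u v) :
    depth v ≤ depth u + w.length := by
  induction w with
  | nil => exact le_self_add
  | cons hadj w ih =>
    rw [SimpleGraph.Walk.length_cons]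
    rcases (h.adj_iff _ _).1 hadj with hP | hP <;> have := h.depth_eq hP <;> omega

theorem dist_eq_depth (h : IsParentRel G depth P r) (v : V) : G.dist r v = depth v := by
  obtain ⟨w, hw⟩ := h.exists_walk v
  obtain ⟨w', hw'⟩ := h.connected.exists_walk_length_eq_dist r v
  have hle := h.depth_le_add_length w'
  rw [h.depth_root, zero_add, hw'] at hle
  exact le_antisymm (hw ▸ SimpleGraph.dist_le w) hle

-- Each edge joins a non-root vertex to its parent, so there are fewer edges than vertices.
theorem isTree [Finite V] (h : IsParentRel G depth P r) : G.IsTree := by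
  choose par hpar hpar_unique using h.existsUnique_parent
  let edge (v : ({r}ᶜ : Set V)) : G.edgeSet :=
    ⟨s(v.1, par v.1 v.2), (h.adj_iff _ _).2 (Or.inl (hpar v.1 v.2))⟩
  have hroot {u v : V} (hP : P u v) : u ≠ r := by
    rintro rfl
    have := h.depth_eq hP
    rw [h.depth_root] at this
    omega
  have hedge {u v : V} (hP : P u v) : (edge ⟨u, hroot hP⟩).1 = s(u, v) :=
    congrArg (fun w => s(u, w)) (hpar_unique u (hroot hP) v hP).symm
  have hsurj : Function.Surjective edge := by
    rintro ⟨⟨u, v⟩, huv⟩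
    rcases (h.adj_iff u v).1 huv with hP | hP
    · exact ⟨_, Subtype.ext (hedge hP)⟩
    · exact ⟨_, Subtype.ext ((hedge hP).trans Sym2.eq_swap)⟩
  have hcard := Nat.card_le_card_of_surjective edge hsurj
  have hcompl := Set.ncard_add_ncard_compl ({r} : Set V)
  rw [Set.ncard_singleton, ← Nat.card_coe_set_eq] at hcompl
  have hlower := h.connected.card_vert_le_card_edgeSet_add_one
  exact SimpleGraph.isTree_iff_connected_and_card.2 ⟨h.connected, by omega⟩

theorem ncard_neighborSet_root (h : IsParentRel G depth P r) :
    (G.neighborSet r).ncard = {u | P u r}.ncard := by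
  congr 1
  ext u
  have hr : ¬ P r u := fun hP => by
    have := h.depth_eq hP
    rw [h.depth_root] at this
    omega
  simp [h.adj_iff, hr]

theorem ncard_neighborSet [Finite V] (h : IsParentRel G depth P r) {v : V} (hv : v ≠ r) :
    (G.neighborSet v).ncard = {u | P u v}.ncard + 1 := by
  obtain ⟨p, hp, hunique⟩ := h.existsUnique_parent v hv
  have hnbr : G.neighborSet v = insert p {u | P u v} := by
    ext u
    have hup : P v u ↔ u = p := ⟨hunique u, fun hu => hu ▸ hp⟩
    simp [h.adj_iff, hup]
  rw [hnbr, Set.ncard_insert_of_notMem]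
  intro hpv
  have := h.depth_eq hp
  have := h.depth_eq hpv
  omega

theorem isCompleteCubicTree [Finite V] {k : ℕ} (h : IsParentRel G depth P r)
    (hk : ∀ v, depth v ≤ k) (hroot : 0 < k → {u | P u r}.ncard = 3)
    (hchild : ∀ v, v ≠ r → depth v < k → {u | P u v}.ncard = 2) : IsCompleteCubicTree G k := by
  refine ⟨h.isTree, r, fun v => ?_⟩
  rw [h.dist_eq_depth]
  refine ⟨hk v, fun hlt => ?_, fun heq => ?_⟩
  · rcases eq_or_ne v r with rfl | hv
    · rw [h.ncard_neighborSet_root, hroot (by omega)]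
    · rw [h.ncard_neighborSet hv, hchild v hv hlt]
  · have hleaf : {u | P u v} = ∅ := Set.eq_empty_of_forall_notMem fun u hu => by
      have := h.depth_eq hu
      have := hk u
      omega
    rcases eq_or_ne v r with rfl | hv
    · rw [h.ncard_neighborSet_root, hleaf, Set.ncard_empty]
      exact zero_le_one
    · rw [h.ncard_neighborSet hv, hleaf, Set.ncard_empty]

end IsParentRel

theorem dist_map_le (hG : G.Connected) (f : G →g H) (u v : V) :
    H.dist (f u) (f v) ≤ G.dist u v := by
  obtain ⟨w, hw⟩ := hG.exists_walk_length_eq_dist u v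
  rw [← hw, ← w.length_map f]
  exact SimpleGraph.dist_le _

theorem IsCompleteCubicTree.of_iso {k : ℕ} (e : G ≃g H) (h : IsCompleteCubicTree G k) :
    IsCompleteCubicTree H k := by
  obtain ⟨hG, r, hr⟩ := h
  have hH := e.isTree_iff.1 hG
  refine ⟨hH, e r, e.surjective.forall.2 fun v => ?_⟩
  have hdist : H.dist (e r) (e v) = G.dist r v := le_antisymm
    (dist_map_le hG.connected e.toHom r v)
    (by simpa using dist_map_le hH.connected e.symm.toHom (e r) (e v))
  have hcard : (H.neighborSet (e v)).ncard = (G.neighborSet v).ncard :=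
    (Nat.card_congr (e.mapNeighborSet v)).symm
  rw [hdist, hcard]
  exact hr v

theorem IsCompleteCubicTree.dist_le {k : ℕ} (h : IsCompleteCubicTree G k) (u v : V) :
    G.dist u v ≤ 2 * k := by
  obtain ⟨hG, r, hr⟩ := h
  have htri := hG.connected.dist_triangle (u := u) (v := r) (w := v)
  have hu := (hr u).1
  have hv := (hr v).1
  rw [SimpleGraph.dist_comm] at hu
  omega

end RootedTree

section PolygonSide

open Classical in
/-- The side of the regular `N`-gon that joins the vertices number `i` and `i + 1`. -/
noncomputable def polygonSide (N i : ℕ) : Finset Plane :=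
  {polygonVertex N i, polygonVertex N (i + 1)}

theorem coe_polygonSide (N i : ℕ) :
    (polygonSide N i : Set Plane) = {polygonVertex N i, polygonVertex N (i + 1)} :=
  Finset.coe_pair

theorem card_polygonSide {N : ℕ} (hN : 2 ≤ N) (i : ℕ) : (polygonSide N i).card = 2 :=
  Finset.card_pair (polygonVertex_ne (by omega) (by omega))

theorem eq_of_cos_two_pi_div_eq {N N' : ℕ} (hN : 3 ≤ N) (hN' : 3 ≤ N')
    (h : Real.cos (2 * Real.pi / N) = Real.cos (2 * Real.pi / N')) : N = N' := by
  have hdiv := Real.injOn_cos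
    ⟨(two_pi_div_pos (by omega)).le, (two_pi_div_lt_pi hN).le⟩
    ⟨(two_pi_div_pos (by omega)).le, (two_pi_div_lt_pi hN').le⟩ h
  rw [div_eq_div_iff (by positivity) (by positivity)] at hdiv
  exact_mod_cast (mul_left_cancel₀ Real.two_pi_pos.ne' hdiv).symm

theorem eq_of_polygonSide_eq {N i j : ℕ} (hN : 3 ≤ N) (hi : i < N) (hj : j < N)
    (h : polygonSide N i = polygonSide N j) : i = j := by
  rw [← Finset.coe_inj, coe_polygonSide, coe_polygonSide, Set.pair_eq_pair_iff] at h
  simp only [polygonVertex_eq_iff (show N ≠ 0 by omega)] at h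
  rcases h with ⟨hij, -⟩ | ⟨hij, hji⟩
  · exact hij.eq_of_lt_of_lt hi hj
  · have h2 : i + 2 ≡ i + 0 [MOD N] := (hji.add_right 1).trans hij.symm
    have := Nat.le_of_dvd two_pos (Nat.modEq_zero_iff_dvd.1 (Nat.ModEq.add_left_cancel' i h2))
    omega

-- The length of a side determines the number of sides of the polygon.
theorem polygonSide_injective {N N' i j : ℕ} (hN : 3 ≤ N) (hN' : 3 ≤ N') (hi : i < N)
    (hj : j < N') (h : polygonSide N i = polygonSide N' j) : N = N' ∧ i = j := by
  obtain rfl : N = N' := by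
    refine eq_of_cos_two_pi_div_eq hN hN' ?_
    rw [← inner_polygonVertex_succ N i, ← inner_polygonVertex_succ N' j]
    rw [← Finset.coe_inj, coe_polygonSide, coe_polygonSide, Set.pair_eq_pair_iff] at h
    rcases h with ⟨h1, h2⟩ | ⟨h1, h2⟩
    · rw [h1, h2]
    · rw [h1, h2, real_inner_comm]
  exact ⟨rfl, eq_of_polygonSide_eq hN hi hj h⟩

theorem subset_triple_iff_of_card_eq_two {α : Type*} [DecidableEq α] {e : Finset α} {a b c : α}
    (he : e.card = 2) : e ⊆ {a, b, c} ↔ e = {a, b} ∨ e = {b, c} ∨ e = {c, a} := by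
  constructor
  · intro h
    obtain ⟨x, y, hxy, rfl⟩ := Finset.card_eq_two.1 he
    simp only [Finset.insert_subset_iff, Finset.singleton_subset_iff, Finset.mem_insert,
      Finset.mem_singleton] at h
    obtain ⟨rfl | rfl | rfl, rfl | rfl | rfl⟩ := h <;> simp_all [Finset.pair_comm]
  · rintro (rfl | rfl | rfl) <;> simp [Finset.insert_subset_iff]

theorem subset_polygonTriangle_three_iff {e : Finset Plane} (he : e.card = 2) :
    e ⊆ polygonTriangle 3 0 1 2 ↔ ∃ i < 3, e = polygonSide 3 i := by
  have h3 : polygonVertex 3 (2 + 1) = polygonVertex 3 0 :=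
    (polygonVertex_eq_iff (by norm_num) _ _).2 rfl
  rw [polygonTriangle, subset_triple_iff_of_card_eq_two he, ← h3]
  constructor
  · rintro (rfl | rfl | rfl)
    exacts [⟨0, by norm_num, h3 ▸ rfl⟩, ⟨1, by norm_num, rfl⟩, ⟨2, by norm_num, rfl⟩]
  · rintro ⟨i, hi, rfl⟩
    interval_cases i
    exacts [Or.inl (h3.symm ▸ rfl), Or.inr (Or.inl rfl), Or.inr (Or.inr rfl)]

theorem subset_outerTriangle_iff {n i : ℕ} {e : Finset Plane} (he : e.card = 2) :
    e ⊆ outerTriangle n i ↔ e = polygonSide (2 * n) (2 * i) ∨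
      e = polygonSide (2 * n) (2 * i + 1) ∨ e = polygonSide n i := by
  rw [outerTriangle, polygonTriangle, subset_triple_iff_of_card_eq_two he, Finset.pair_comm
    (polygonVertex (2 * n) (2 * i + 2)), polygonVertex_double, ← mul_add_one, polygonVertex_double]
  simp only [polygonSide, polygonVertex_double, add_assoc, ← mul_add_one, one_add_one_eq_two]

end PolygonSide

section DualTree

/-- The number of triangles at distance `j` from the root of the dual tree. -/
def levelCard : ℕ → ℕ
  | 0 => 1
  | j + 1 => 3 * 2 ^ j

/-- The triangle number `i` at distance `j` from the root of the dual tree. -/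
noncomputable def levelTriangle : ℕ → ℕ → Finset Plane
  | 0, _ => polygonTriangle 3 0 1 2
  | j + 1, i => outerTriangle (3 * 2 ^ j) i

/-- `HasSide j i l m` says that the side number `m` of the regular `3 * 2 ^ l`-gon is a side of
`levelTriangle j i`. Such a side belongs to one triangle inside this polygon, at level `l`, and to
the outer triangle number `m` at level `l + 1`. -/
def HasSide (j i l m : ℕ) : Prop :=
  m < 3 * 2 ^ l ∧ ((j = l ∧ (l = 0 ∨ m / 2 = i)) ∨ (j = l + 1 ∧ m = i))

theorem mem_recursiveTriangles_iff {k : ℕ} {T : Finset Plane} : T ∈ recursiveTriangles k ↔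
    ∃ j i, j ≤ k ∧ i < levelCard j ∧ levelTriangle j i = T := by
  induction k with
  | zero =>
    rw [mem_recursiveTriangles_zero]
    constructor
    · exact fun h => ⟨0, 0, le_rfl, Nat.one_pos, h.symm⟩
    · rintro ⟨j, i, hj, -, rfl⟩
      rw [Nat.le_zero.1 hj, levelTriangle]
  | succ k ih =>
    rw [mem_recursiveTriangles_succ, ih]
    constructor
    · rintro (⟨i, hi, rfl⟩ | ⟨j, i, hj, h⟩)
      · exact ⟨k + 1, i, le_rfl, hi, rfl⟩
      · exact ⟨j, i, hj.trans k.le_succ, h⟩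
    · rintro ⟨j, i, hj, hi, rfl⟩
      rcases Nat.le_succ_iff.1 hj with hj | rfl
      · exact Or.inr ⟨j, i, hj, hi, rfl⟩
      · exact Or.inl ⟨i, hi, rfl⟩

theorem subset_levelTriangle_iff {j i : ℕ} {e : Finset Plane} (hi : i < levelCard j)
    (he : e.card = 2) :
    e ⊆ levelTriangle j i ↔ ∃ l m, HasSide j i l m ∧ e = polygonSide (3 * 2 ^ l) m := by
  cases j with
  | zero =>
    rw [levelTriangle, subset_polygonTriangle_three_iff he]
    constructor
    · rintro ⟨m, hm, rfl⟩
      exact ⟨0, m, ⟨hm, Or.inl ⟨rfl, Or.inl rfl⟩⟩, rfl⟩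
    · rintro ⟨l, m, ⟨hm, ⟨rfl, -⟩ | ⟨h, -⟩⟩, rfl⟩
      · exact ⟨m, hm, rfl⟩
      · omega
  | succ j =>
    rw [levelTriangle, subset_outerTriangle_iff he, ← three_mul_two_pow_succ]
    rw [levelCard] at hi
    have := three_mul_two_pow_succ j
    constructor
    · rintro (rfl | rfl | rfl)
      · exact ⟨j + 1, 2 * i, ⟨by omega, by omega⟩, rfl⟩
      · exact ⟨j + 1, 2 * i + 1, ⟨by omega, by omega⟩, rfl⟩
      · exact ⟨j, i, ⟨hi, Or.inr ⟨rfl, rfl⟩⟩, rfl⟩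
    · rintro ⟨l, m, ⟨-, ⟨rfl, hm⟩ | ⟨hl, rfl⟩⟩, rfl⟩
      · obtain rfl | rfl : m = 2 * i ∨ m = 2 * i + 1 := by omega
        exacts [Or.inl rfl, Or.inr (Or.inl rfl)]
      · rw [Nat.succ_injective hl]
        exact Or.inr (Or.inr rfl)

theorem polygonSide_subset_levelTriangle_iff {j i l m : ℕ} (hi : i < levelCard j)
    (hm : m < 3 * 2 ^ l) : polygonSide (3 * 2 ^ l) m ⊆ levelTriangle j i ↔ HasSide j i l m := by
  have h3 := three_le_three_mul_two_pow
  rw [subset_levelTriangle_iff hi (card_polygonSide (Nat.le_of_succ_le (h3 l)) m)]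
  constructor
  · rintro ⟨l', m', h, heq⟩
    obtain ⟨hpow, rfl⟩ := polygonSide_injective (h3 l) (h3 l') hm h.1 heq
    obtain rfl := Nat.pow_right_injective le_rfl (Nat.mul_left_cancel three_pos hpow)
    exact h
  · exact fun h => ⟨l, m, h, rfl⟩

theorem hasSide_two_mul {j i : ℕ} (hi : i < levelCard j) : HasSide j i j (2 * i) := by
  cases j with
  | zero => exact ⟨by rw [levelCard] at hi; omega, Or.inl ⟨rfl, Or.inl rfl⟩⟩
  | succ j =>
    rw [levelCard] at hi
    have := three_mul_two_pow_succ j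
    exact ⟨by omega, Or.inl ⟨rfl, by omega⟩⟩

theorem levelTriangle_injective {j i j' i' : ℕ} (hi : i < levelCard j) (hi' : i' < levelCard j')
    (h : levelTriangle j i = levelTriangle j' i') : j = j' ∧ i = i' := by
  have hside := hasSide_two_mul hi
  have hside' := hasSide_two_mul hi'
  have h1 := (polygonSide_subset_levelTriangle_iff hi hside.1).2 hside
  have h2 := (polygonSide_subset_levelTriangle_iff hi' hside'.1).2 hside'
  rw [h, polygonSide_subset_levelTriangle_iff hi' hside.1] at h1
  rw [← h, polygonSide_subset_levelTriangle_iff hi hside'.1] at h2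
  obtain ⟨-, h1⟩ := h1
  obtain ⟨-, h2⟩ := h2
  obtain rfl : j = j' := by omega
  cases j with
  | zero => rw [levelCard] at hi hi'; omega
  | succ j => omega

/-- The positions of the triangles in the dual tree of `recursiveModel k`. -/
@[ext]
structure Position (k : ℕ) where
  /-- the distance from the root -/
  level : ℕ
  /-- the number of the triangle within its level -/
  index : ℕ
  level_le : level ≤ k
  index_lt : index < levelCard level

namespace Position

variable {k : ℕ}

/-- The position of the central triangle. -/
def root (k : ℕ) : Position k := ⟨0, 0, Nat.zero_le k, Nat.one_pos⟩

/-- The triangle at position `p` is a child of the triangle at position `q` in the dual tree. -/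
def IsChild (p q : Position k) : Prop :=
  p.level = q.level + 1 ∧ (q.level = 0 ∨ p.index / 2 = q.index)

theorem eq_root_iff {p : Position k} : p = root k ↔ p.level = 0 := by
  refine ⟨fun h => h ▸ rfl, fun h => Position.ext h ?_⟩
  have := p.index_lt
  rw [h] at this
  exact Nat.lt_one_iff.1 this

theorem eq_of_isChild {p q q' : Position k} (h : IsChild p q) (h' : IsChild p q') : q = q' := by
  have hlevel : q.level = q'.level := Nat.succ_injective (h.1.symm.trans h'.1)
  rcases Nat.eq_zero_or_pos q.level with h0 | hpos
  · exact (eq_root_iff.2 h0).trans (eq_root_iff.2 (hlevel.symm.trans h0)).symm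
  · exact Position.ext hlevel <|
      (h.2.resolve_left hpos.ne').symm.trans (h'.2.resolve_left (hlevel ▸ hpos.ne'))

theorem existsUnique_isChild {p : Position k} (hp : p ≠ root k) : ∃! q, IsChild p q := by
  suffices h : ∃ q, IsChild p q from h.imp fun q hq => ⟨hq, fun q' hq' => eq_of_isChild hq' hq⟩
  obtain ⟨level, i, hk, hi⟩ := p
  match level, hk, hi with
  | 0, _, _ => exact (hp (eq_root_iff.2 rfl)).elim
  | 1, _, _ => exact ⟨root k, rfl, Or.inl rfl⟩
  | j + 2, hk, hi =>
    rw [levelCard, three_mul_two_pow_succ] at hi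
    exact ⟨⟨j + 1, i / 2, by omega, by rw [levelCard]; omega⟩, rfl, Or.inr rfl⟩

/-- The correspondence between the positions and the triangles. -/
noncomputable def equivTriangles (k : ℕ) : Position k ≃ triangles (recursiveModel k) :=
  Equiv.ofBijective
    (fun p => ⟨levelTriangle p.level p.index, by
      rw [triangles_recursiveModel]
      exact mem_recursiveTriangles_iff.2 ⟨_, _, p.level_le, p.index_lt, rfl⟩⟩) (by
    constructor
    · intro p q h
      exact Position.ext_iff.2
        (levelTriangle_injective p.index_lt q.index_lt (congrArg Subtype.val h))
    · rintro ⟨T, hT⟩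
      rw [triangles_recursiveModel] at hT
      obtain ⟨j, i, hj, hi, rfl⟩ := mem_recursiveTriangles_iff.1 hT
      exact ⟨⟨j, i, hj, hi⟩, rfl⟩)

theorem isChild_or_isChild_of_hasSide {p q : Position k} (hpq : p ≠ q) {l m : ℕ}
    (hp : HasSide p.level p.index l m) (hq : HasSide q.level q.index l m) :
    IsChild p q ∨ IsChild q p := by
  obtain ⟨-, ⟨hpl, hp⟩ | ⟨hpl, hp⟩⟩ := hp <;> obtain ⟨-, ⟨hql, hq⟩ | ⟨hql, hq⟩⟩ := hq
  · refine (hpq ?_).elim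
    rcases Nat.eq_zero_or_pos l with rfl | hl
    · rw [eq_root_iff.2 hpl, eq_root_iff.2 hql]
    · exact Position.ext (hpl.trans hql.symm) (by omega)
  · exact Or.inr ⟨by omega, by omega⟩
  · exact Or.inl ⟨by omega, by omega⟩
  · exact (hpq (Position.ext (hpl.trans hql.symm) (hp.symm.trans hq))).elim

theorem IsChild.hasSide {p q : Position k} (h : IsChild p q) :
    HasSide p.level p.index q.level p.index ∧ HasSide q.level q.index q.level p.index := by
  have hlt := p.index_lt
  rw [h.1, levelCard] at hlt
  exact ⟨⟨hlt, Or.inr ⟨h.1, rfl⟩⟩, ⟨hlt, Or.inl ⟨rfl, h.2⟩⟩⟩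

theorem adj_of_isChild {p q : Position k} (h : IsChild p q) :
    (dualGraph (recursiveModel k)).Adj (equivTriangles k p) (equivTriangles k q) := by
  obtain ⟨hp, hq⟩ := h.hasSide
  have hne : p ≠ q := fun hpq => by
    have := h.1
    rw [hpq] at this
    omega
  have hcard : (polygonSide (3 * 2 ^ q.level) p.index).card = 2 :=
    card_polygonSide (Nat.le_of_succ_le (three_le_three_mul_two_pow _)) _
  have hsub := (polygonSide_subset_levelTriangle_iff p.index_lt hp.1).2 hp
  refine ⟨(equivTriangles k).injective.ne hne, _, ?_, hcard, hsub,
    (polygonSide_subset_levelTriangle_iff q.index_lt hq.1).2 hq⟩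
  exact (recursiveModel k).down_closed (equivTriangles k p).2.1 hsub
    (Finset.card_pos.1 (by rw [hcard]; exact two_pos))

theorem adj_equivTriangles_iff {p q : Position k} :
    (dualGraph (recursiveModel k)).Adj (equivTriangles k p) (equivTriangles k q) ↔
      IsChild p q ∨ IsChild q p := by
  constructor
  · rintro ⟨hne, e, -, he, hp, hq⟩
    obtain ⟨l, m, hlm, rfl⟩ := (subset_levelTriangle_iff p.index_lt he).1 hp
    exact isChild_or_isChild_of_hasSide (fun h => hne (congrArg _ h)) hlm
      ((polygonSide_subset_levelTriangle_iff q.index_lt hlm.1).1 hq)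
  · rintro (h | h)
    exacts [adj_of_isChild h, (adj_of_isChild h).symm]

theorem isParentRel (k : ℕ) :
    IsParentRel ((dualGraph (recursiveModel k)).comap (equivTriangles k))
      level IsChild (root k) where
  depth_root := rfl
  depth_eq _ _ h := h.1
  existsUnique_parent _ := existsUnique_isChild
  adj_iff _ _ := adj_equivTriangles_iff

theorem ncard_children_root (hk : 0 < k) : {p : Position k | IsChild p (root k)}.ncard = 3 := by
  refine Set.ncard_eq_three.2 ⟨⟨1, 0, hk, three_pos⟩, ⟨1, 1, hk, by decide⟩, ⟨1, 2, hk, by decide⟩,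
    by simp [Position.ext_iff], by simp [Position.ext_iff], by simp, ?_⟩
  ext p
  have hp := p.index_lt
  simp only [Set.mem_ofPred_eq, Set.mem_insert_iff, Set.mem_singleton_iff, Position.ext_iff, root,
    IsChild, true_or, and_true]
  constructor
  · intro h
    rw [h, zero_add, levelCard] at hp
    omega
  · omega

theorem ncard_children {q : Position k} (hq : q ≠ root k) (hk : q.level < k) :
    {p : Position k | IsChild p q}.ncard = 2 := by
  rw [Ne, eq_root_iff] at hq
  obtain ⟨j, i, hj, hi⟩ := q
  obtain ⟨j, rfl⟩ := Nat.exists_eq_add_one_of_ne_zero hq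
  have hcard : levelCard (j + 2) = 2 * levelCard (j + 1) := three_mul_two_pow_succ j
  refine Set.ncard_eq_two.2 ⟨⟨j + 2, 2 * i, hk, by omega⟩, ⟨j + 2, 2 * i + 1, hk, by omega⟩,
    by simp, ?_⟩
  ext p
  simp only [Set.mem_ofPred_eq, Set.mem_insert_iff, Set.mem_singleton_iff, Position.ext_iff,
    IsChild]
  omega

/-- The positions as pairs of a level and a number within the level. -/
def equivSigma (k : ℕ) : Position k ≃ Σ j : Fin (k + 1), Fin (levelCard j) where
  toFun p := ⟨⟨p.level, Nat.lt_succ_of_le p.level_le⟩, ⟨p.index, p.index_lt⟩⟩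
  invFun p := ⟨p.1, p.2, Nat.le_of_lt_succ p.1.2, p.2.2⟩
  left_inv _ := rfl
  right_inv _ := rfl

instance : Finite (Position k) := Finite.of_equiv _ (equivSigma k).symm

theorem card_eq (k : ℕ) : Nat.card (Position k) = 3 * (2 ^ k - 1) + 1 := by
  rw [Nat.card_congr (equivSigma k), Nat.card_eq_fintype_card, Fintype.card_sigma]
  simp only [Fintype.card_fin]
  rw [Fin.sum_univ_eq_sum_range]
  induction k with
  | zero => rfl
  | succ k ih =>
    rw [Finset.sum_range_succ, ih, levelCard, pow_succ]
    have : 0 < 2 ^ k := by positivity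
    omega

end Position

theorem numTriangles_recursiveModel (k : ℕ) :
    numTriangles (recursiveModel k) = 3 * (2 ^ k - 1) + 1 := by
  rw [← Position.card_eq, Nat.card_congr (Position.equivTriangles k)]
  rfl

theorem isCompleteCubicTree_recursiveModel (k : ℕ) :
    IsCompleteCubicTree (dualGraph (recursiveModel k)) k :=
  .of_iso (SimpleGraph.Iso.comap (Position.equivTriangles k) _) <|
    (Position.isParentRel k).isCompleteCubicTree Position.level_le Position.ncard_children_root
      fun _ => Position.ncard_children

theorem le_logb_numTriangles_recursiveModel (k : ℕ) :
    (k : ℝ) ≤ Real.logb 2 (numTriangles (recursiveModel k)) := by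
  have hpow : 2 ^ k ≤ numTriangles (recursiveModel k) := by
    rw [numTriangles_recursiveModel]
    have : 0 < 2 ^ k := by positivity
    omega
  have hpow' : (2 : ℝ) ^ k ≤ numTriangles (recursiveModel k) := by exact_mod_cast hpow
  rwa [Real.le_logb_iff_rpow_le one_lt_two (lt_of_lt_of_le (by positivity) hpow'),
    Real.rpow_natCast]

end DualTree

end TriangleStrips

theorem theorem3 :
    ∃ M : ℕ → Geometry.SimplicialComplex ℝ (EuclideanSpace ℝ (Fin 2)),
      (∀ k : ℕ,
        TriangleStrips.IsTriangulatedModel (M k) ∧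
        TriangleStrips.triangles (M k) = TriangleStrips.recursiveTriangles k ∧
        (M k).space = convexHull ℝ
          (Set.range fun i : Fin (3 * 2 ^ k) => TriangleStrips.polygonVertex (3 * 2 ^ k) i) ∧
        Nonempty ((M k).space ≃ₜ TriangleStrips.sphereWithHole) ∧
        TriangleStrips.IsCompleteCubicTree (TriangleStrips.dualGraph (M k)) k ∧
        TriangleStrips.numTriangles (M k) = 3 * (2 ^ k - 1) + 1) ∧
      ∃ C : ℝ, ∀ (k : ℕ) (L : Geometry.SimplicialComplex ℝ (EuclideanSpace ℝ (Fin 2))),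
        TriangleStrips.IsSubdivision L (M k) →
        ∀ (s t : TriangleStrips.triangles L) (p : (TriangleStrips.dualGraph L).Walk s t),
          TriangleStrips.IsSingleStrip L p →
            3 * (TriangleStrips.numTriangles (M k) : ℝ)
                - 4 * Real.logb 2 (TriangleStrips.numTriangles (M k)) - C
              ≤ (p.support.length : ℝ) := by
  refine ⟨TriangleStrips.recursiveModel, fun k =>
    ⟨TriangleStrips.isTriangulatedModel_recursiveModel k,
      TriangleStrips.triangles_recursiveModel k, TriangleStrips.space_recursiveModel k,
      TriangleStrips.nonempty_homeomorph_sphereWithHole k,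
      TriangleStrips.isCompleteCubicTree_recursiveModel k,
      TriangleStrips.numTriangles_recursiveModel k⟩, 2, fun k L hL s t p hp => ?_⟩
  have : Fact (Module.finrank ℝ (EuclideanSpace ℝ (Fin 2)) = 2) := ⟨by simp⟩
  have htree := TriangleStrips.isCompleteCubicTree_recursiveModel k
  have hlength : 3 * (TriangleStrips.numTriangles (TriangleStrips.recursiveModel k) : ℝ) ≤
      p.support.length + 2 * (2 * k) + 2 := by
    exact_mod_cast TriangleStrips.three_mul_numTriangles_le hL htree.1 htree.dist_le hp
  have hlog := TriangleStrips.le_logb_numTriangles_recursiveModel k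
  linarith
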